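/- Let $d\ge 3$ and $\rho>0$. Let $G(x)=(G_{jk}(x))$ be a smooth function on $\mathbb R^d$ with values in the positive definite symmetric real $d\times d$ matrices and let $a\in C^\infty(\mathbb R^d)$ be real valued with $a\ge 0$, such that for all $j,k$ and all $\alpha\in\mathbb N^d$ there is $c_\alpha$ with $$|\partial^\alpha(G_{jk}(x)-\delta_{jk})|\le c_\alpha\langle x\rangle^{-\rho-|\alpha|},\qquad |\partial^\alpha a(x)|\le c_\alpha\langle x\rangle^{-1-\rho-|\alpha|}\qquad(x\in\mathbb R^d),$$ where $\langle x\rangle=(1+|x|^2)^{1/2}$. Let $H_0=-\operatorname{div}(G\nabla)$, acting on tempered distributions. For $\operatorname{Im}z>0$ let $R(z)=(H_0-iza-z^2)^{-1}$ be the inverse of the operator $H_0-iza-z^2$ with domain $H^2(\mathbb R^d)$ on $L^2(\mathbb R^d)$; it is a well-defined bounded operator on $L^2$. Let $\mathcal H=\dot H^1\times L^2$, where $\dot H^1=\{u\in L^{2d/(d-2)}:\nabla u\in L^2\}$, with the norm $$\|(u,v)\|_{\mathcal H}^2=\|H_0^{1/2}u\|_{L^2}^2+\|v\|_{L^2}^2,\qquad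 \|H_0^{1/2}u\|_{L^2}^2=\langle G\nabla u,\nabla u\rangle_{L^2} ;$$ this is a Hilbert space in which $\mathcal S(\mathbb R^d)\times\mathcal S(\mathbb R^d)$ is dense, that is, the Hilbert completion of $\mathcal S\times\mathcal S$ for this norm. Let $$\mathcal A=\begin{pmatrix}0&I\\ H_0&-ia\end{pmatrix},\qquad \mathcal D(\mathcal A)=\{(u,v)\in\mathcal H : (v,H_0u)\in\mathcal H\},$$ where $H_0u$ is taken in the sense of tempered distributions, and equip $\mathcal D(\mathcal A)$ with the norm $\|(u,v)\|_{\mathcal H}+\|H_0u\|_{L^2}+\|H_0^{1/2}v\|_{L^2}$. Then: (i) For all $z\in\mathbb C$ with $\operatorname{Im}z>0$, the operator $$\begin{pmatrix}R(z)(ia+z)&R(z)\\ I+R(z)(zia+z^2)&zR(z)\end{pmatrix},$$ defined on $\mathcal S(\mathbb R^d)\times\mathcal S(\mathbb R^d)$, has a closure which is a bounded operator from $\mathcal H$ to $\mathcal D(\mathcal A)$; it is denoted by $\mathcal R_{\mathcal A}(z)$. (ii) The operator $\mathcal A$ is maximal dissipative on $\mathcal H$: $\operatorname{Im}\langle\mathcal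 A\varphi,\varphi\rangle_{\mathcal H}\le 0$ for all $\varphi\in\mathcal D(\mathcal A)$ (with the inner product antilinear on the right), and $\mathcal A$ has no other dissipative extension on $\mathcal H$ than itself. Moreover, for all $z$ with $\operatorname{Im}z>0$, $\mathcal R_{\mathcal A}(z)$ is the two-sided inverse of $\mathcal A-z$, i.e. $(\mathcal A-z)^{-1}=\mathcal R_{\mathcal A}(z)$. -/

import Mathlib

open MeasureTheory SchwartzMap TemperedDistribution LineDeriv
open scoped ENNReal ContDiff

noncomputable section

namespace DampedWave

/-- Euclidean space `ℝ^d`. -/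
abbrev Space (d : ℕ) : Type := EuclideanSpace ℝ (Fin d)

/-- The complex Hilbert space `L²(ℝ^d)`. -/
abbrev L2 (d : ℕ) : Type := Lp ℂ 2 (volume : Measure (Space d))

/-- The `j`-th vector of the canonical basis of `ℝ^d`. -/
abbrev basisVec {d : ℕ} (j : Fin d) : Space d := EuclideanSpace.single j 1

/-- `⟨x⟩ = (1 + |x|²)^{1/2}`. -/
def bracket {d : ℕ} (x : Space d) : ℝ := Real.sqrt (1 + ‖x‖ ^ 2)

/-- The coefficients of the damped wave equation: a long range metric perturbation `G` of the
identity and a short range absorption index `a ≥ 0`. The size of the `n`-th Fréchet derivative at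
`x` is comparable to the largest of the `|∂^α|` with `|α| = n`. -/
structure Medium (d : ℕ) where
  /-- the matrix `G(x)` -/
  G : Space d → Matrix (Fin d) (Fin d) ℝ
  /-- the absorption index -/
  a : Space d → ℝ
  /-- the rate of decay -/
  ρ : ℝ
  ρ_pos : 0 < ρ
  G_posDef : ∀ x, (G x).PosDef
  G_smooth : ∀ j k, ContDiff ℝ ∞ (fun x => G x j k)
  G_longRange : ∀ j k, ∀ n : ℕ, ∃ c : ℝ, ∀ x,
    ‖iteratedFDeriv ℝ n (fun y => G y j k - if j = k then 1 else 0) x‖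
      ≤ c * bracket x ^ (-ρ - n)
  a_nonneg : ∀ x, 0 ≤ a x
  a_smooth : ContDiff ℝ ∞ a
  a_shortRange : ∀ n : ℕ, ∃ c : ℝ, ∀ x,
    ‖iteratedFDeriv ℝ n a x‖ ≤ c * bracket x ^ (-1 - ρ - n)

/-! ### Elementary facts: bounded coefficients -/

theorem one_le_bracket {d : ℕ} (x : Space d) : 1 ≤ bracket x := by
  unfold bracket
  rw [Real.one_le_sqrt]
  nlinarith [sq_nonneg ‖x‖]

theorem bounded_of_decay {d : ℕ} {f : Space d → ℝ} {c s : ℝ} (hs : s ≤ 0)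
    (h : ∀ x, ‖f x‖ ≤ c * bracket x ^ s) (x : Space d) : ‖f x‖ ≤ |c| := by
  have h1 : bracket x ^ s ≤ 1 := Real.rpow_le_one_of_one_le_of_nonpos (one_le_bracket x) hs
  have h0 : 0 ≤ bracket x ^ s := Real.rpow_nonneg (le_trans zero_le_one (one_le_bracket x)) s
  calc ‖f x‖ ≤ c * bracket x ^ s := h x
    _ ≤ |c| * bracket x ^ s := mul_le_mul_of_nonneg_right (le_abs_self c) h0
    _ ≤ |c| * 1 := mul_le_mul_of_nonneg_left h1 (abs_nonneg c)
    _ = |c| := mul_one _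

namespace Medium

variable {d : ℕ} (M : Medium d)

theorem memLp_G (j k : Fin d) :
    MemLp (fun x => (M.G x j k : ℂ)) ∞ (volume : Measure (Space d)) := by
  obtain ⟨c, hc⟩ := M.G_longRange j k 0
  have hb := bounded_of_decay (f := fun y => M.G y j k - if j = k then 1 else 0) (c := c)
    (s := -M.ρ) (by linarith [M.ρ_pos]) (fun x => by simpa using hc x)
  refine memLp_top_of_bound (C := |c| + 1) ?_ (Filter.Eventually.of_forall fun x => ?_)
  · exact (Complex.continuous_ofReal.comp (M.G_smooth j k).continuous).aestronglyMeasurable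
  · have h1 : ‖(if j = k then (1 : ℝ) else 0)‖ ≤ 1 := by split_ifs <;> simp
    have h2 := norm_add_le (M.G x j k - if j = k then 1 else 0) (if j = k then (1 : ℝ) else 0)
    rw [sub_add_cancel] at h2
    rw [Complex.norm_real]
    linarith [hb x]

theorem memLp_a : MemLp (fun x => (M.a x : ℂ)) ∞ (volume : Measure (Space d)) := by
  obtain ⟨c, hc⟩ := M.a_shortRange 0
  have hb := bounded_of_decay (f := M.a) (c := c)
    (s := -1 - M.ρ) (by linarith [M.ρ_pos]) (fun x => by simpa using hc x)
  refine memLp_top_of_bound (C := |c|) ?_ (Filter.Eventually.of_forall fun x => ?_)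
  · exact (Complex.continuous_ofReal.comp M.a_smooth.continuous).aestronglyMeasurable
  · rw [Complex.norm_real]
    exact hb x

end Medium

/-- Multiplication by a bounded function, as a bounded operator on `L²`. -/
def mulL2 {d : ℕ} (g : Space d → ℂ) (hg : MemLp g ∞ (volume : Measure (Space d))) :
    L2 d →L[ℂ] L2 d :=
  (ContinuousLinearMap.mul ℂ ℂ).holderL volume ∞ 2 2 hg.toLp

theorem mulL2_coeFn {d : ℕ} (g : Space d → ℂ) (hg : MemLp g ∞ (volume : Measure (Space d)))
    (f : L2 d) : mulL2 g hg f =ᵐ[volume] fun x => g x * f x := by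
  have h := (ContinuousLinearMap.mul ℂ ℂ).coeFn_holder (r := 2) hg.toLp f
  filter_upwards [h, hg.coeFn_toLp] with x hx hx'
  simpa [mulL2, hx'] using hx

/-- Multiplication by the entry `G_{jk}`, on `L²`. -/
def Medium.mulG {d : ℕ} (M : Medium d) (j k : Fin d) : L2 d →L[ℂ] L2 d :=
  mulL2 (fun x => (M.G x j k : ℂ)) (M.memLp_G j k)

/-- Multiplication by the absorption index `a`, on `L²`. -/
def Medium.mulA {d : ℕ} (M : Medium d) : L2 d →L[ℂ] L2 d :=
  mulL2 (fun x => (M.a x : ℂ)) M.memLp_a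

/-- The operator `H₀ = - div (G ∇) = - ∑_{j,k} ∂_j G_{jk} ∂_k` on tempered distributions. -/
def Medium.H0 {d : ℕ} (M : Medium d) : 𝓢'(Space d, ℂ) →L[ℂ] 𝓢'(Space d, ℂ) :=
  -∑ j, ∑ k, lineDerivOpCLM ℂ 𝓢'(Space d, ℂ) (basisVec j) ∘L
    smulLeftCLM ℂ (fun x => (M.G x j k : ℂ)) ∘L lineDerivOpCLM ℂ 𝓢'(Space d, ℂ) (basisVec k)

/-! ### The resolvent `R(z)` -/

/-- `R` is the bounded inverse on `L²` of the operator `H₀ - i z a - z²` with domain `H²`. -/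
def Medium.IsInverse {d : ℕ} (M : Medium d) (z : ℂ) (R : L2 d →L[ℂ] L2 d) : Prop :=
  ∀ f u : L2 d, R f = u ↔ MemSobolev 2 2 (u : 𝓢'(Space d, ℂ)) ∧
    M.H0 (u : 𝓢'(Space d, ℂ)) - ((Complex.I * z) • M.mulA u + z ^ 2 • u : L2 d)
      = (f : 𝓢'(Space d, ℂ))

open Classical in
/-- `R(z) = (H₀ - i z a - z²)⁻¹`, the inverse of the operator with domain `H²` on `L²`
(and `0` for those `z` for which there is no bounded inverse). -/
def Medium.R {d : ℕ} (M : Medium d) (z : ℂ) : L2 d →L[ℂ] L2 d :=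
  if h : ∃ R : L2 d →L[ℂ] L2 d, M.IsInverse z R then h.choose else 0

/-! ### `L²` inside the tempered distributions -/

/-- The embedding of `L²` in the space of tempered distributions. -/
def l2Emb (d : ℕ) : L2 d →ₗ[ℂ] 𝓢'(Space d, ℂ) :=
  (Lp.toTemperedDistributionCLM ℂ (volume : Measure (Space d)) 2 : L2 d →L[ℂ] 𝓢'(Space d, ℂ))

theorem lp_toTemperedDistribution_injective {d : ℕ} (p : ℝ≥0∞) [Fact (1 ≤ p)] :
    Function.Injective
      (Lp.toTemperedDistributionCLM ℂ (volume : Measure (Space d)) p) :=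
  LinearMap.ker_eq_bot.mp (Lp.ker_toTemperedDistributionCLM_eq_bot (F := ℂ)
    (μ := (volume : Measure (Space d))) (p := p))

theorem l2Emb_injective (d : ℕ) : Function.Injective (l2Emb d) :=
  lp_toTemperedDistribution_injective 2

/-- The `L²` function which represents a distribution belonging to `L²`. -/
def l2Rep (d : ℕ) : LinearMap.range (l2Emb d) →ₗ[ℂ] L2 d :=
  (LinearEquiv.ofInjective (l2Emb d) (l2Emb_injective d)).symm.toLinearMap

theorem l2Emb_l2Rep {d : ℕ} (u : LinearMap.range (l2Emb d)) : l2Emb d (l2Rep d u) = u := by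
  have h := (LinearEquiv.ofInjective (l2Emb d) (l2Emb_injective d)).apply_symm_apply u
  exact congrArg Subtype.val h

/-! ### The homogeneous Sobolev space -/

/-- The Sobolev exponent `2d / (d - 2)`. -/
def sobolevExp (d : ℕ) : ℝ≥0∞ := ENNReal.ofReal (2 * d / (d - 2))

instance one_le_sobolevExp (d : ℕ) [hd : Fact (3 ≤ d)] : Fact (1 ≤ sobolevExp d) := by
  have h3 : (3 : ℝ) ≤ d := by exact_mod_cast hd.out
  refine ⟨?_⟩
  unfold sobolevExp
  rw [← ENNReal.ofReal_one]
  refine ENNReal.ofReal_le_ofReal ?_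
  rw [le_div_iff₀ (by linarith)]
  linarith

/-- `Ḣ¹ = {u ∈ L^{2d/(d-2)} | ∇u ∈ L²}`, as a space of tempered distributions. -/
def hdot (d : ℕ) [Fact (3 ≤ d)] : Submodule ℂ 𝓢'(Space d, ℂ) where
  carrier := {u | (∃ f : Lp ℂ (sobolevExp d) (volume : Measure (Space d)), u = f) ∧
    ∀ j : Fin d, ∃ g : L2 d, ∂_{basisVec j} u = (g : 𝓢'(Space d, ℂ))}
  zero_mem' := by
    refine ⟨⟨0, ?_⟩, fun j => ⟨0, ?_⟩⟩
    · exact (map_zero (Lp.toTemperedDistributionCLM ℂ volume (sobolevExp d))).symm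
    · exact ((lineDerivOpCLM ℂ 𝓢'(Space d, ℂ) (basisVec j)).map_zero).trans
        (map_zero (l2Emb d)).symm
  add_mem' := by
    rintro u w ⟨⟨f, hf⟩, hu⟩ ⟨⟨g, hg⟩, hw⟩
    refine ⟨⟨f + g, ?_⟩, fun j => ?_⟩
    · rw [hf, hg]
      exact (map_add (Lp.toTemperedDistributionCLM ℂ volume (sobolevExp d)) f g).symm
    · obtain ⟨f', hf'⟩ := hu j
      obtain ⟨g', hg'⟩ := hw j
      refine ⟨f' + g', ?_⟩
      rw [lineDerivOp_add, hf', hg']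
      exact (map_add (l2Emb d) f' g').symm
  smul_mem' := by
    rintro c u ⟨⟨f, hf⟩, hu⟩
    refine ⟨⟨c • f, ?_⟩, fun j => ?_⟩
    · rw [hf]
      exact (map_smul (Lp.toTemperedDistributionCLM ℂ volume (sobolevExp d)) c f).symm
    · obtain ⟨f', hf'⟩ := hu j
      refine ⟨c • f', ?_⟩
      rw [lineDerivOp_smul, hf']
      exact (map_smul (l2Emb d) c f').symm

theorem schwartz_mem_hdot {d : ℕ} [Fact (3 ≤ d)] (f : 𝓢(Space d, ℂ)) :
    (f : 𝓢'(Space d, ℂ)) ∈ hdot d := by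
  refine ⟨⟨f.toLp (sobolevExp d), ?_⟩, fun j => ⟨(∂_{basisVec j} f).toLp 2, ?_⟩⟩
  · rw [Lp.toTemperedDistribution_toLp_eq]
  · rw [Lp.toTemperedDistribution_toLp_eq, lineDerivOp_toTemperedDistributionCLM_eq]

/-! ### A function in `L^p`, `p < ∞`, whose gradient vanishes is zero -/

section Liouville

open scoped Convolution
open ContinuousLinearMap (lsmul)

variable {d : ℕ} {p : ℝ≥0∞} [hp : Fact (1 ≤ p)]

theorem integral_translate_const (u : Lp ℂ p (volume : Measure (Space d)))
    (hu : ∀ j : Fin d, ∂_{basisVec j} (u : 𝓢'(Space d, ℂ)) = 0)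
    (g : Space d → ℝ) (hg : ContDiff ℝ ∞ g) (hgc : HasCompactSupport g) (x y : Space d) :
    ∫ t, g (x - t) • u t = ∫ t, g (y - t) • u t := by
  let L : ℂ →L[ℝ] ℝ →L[ℝ] ℂ := (lsmul ℝ ℝ).flip
  have hloc : LocallyIntegrable u (volume : Measure (Space d)) :=
    (Lp.memLp u).locallyIntegrable hp.out
  have hg1 : ContDiff ℝ 1 g := hg.of_le (by exact_mod_cast le_top)
  have hd := fun x₀ => hgc.hasFDerivAt_convolution_right L hloc hg1 x₀
  have key : ∀ x₀, (u ⋆[L.precompR (Space d), volume] fderiv ℝ g) x₀ = 0 := by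
    intro x₀
    have hz : ∀ j : Fin d,
        (u ⋆[L.precompR (Space d), volume] fderiv ℝ g) x₀ (basisVec j) = 0 := by
      intro j
      rw [convolution_precompR_apply L hloc (hgc.fderiv ℝ) (hg1.continuous_fderiv one_ne_zero)]
      have hψ1 : HasCompactSupport (fun t => (g (x₀ - t) : ℂ)) := by
        have h1 : HasCompactSupport (g ∘ (Homeomorph.subLeft x₀)) :=
          hgc.comp_homeomorph (Homeomorph.subLeft x₀)
        exact h1.comp_left (g := fun r : ℝ => (r : ℂ)) (by simp)
      have hψ2 : ContDiff ℝ ∞ (fun t => (g (x₀ - t) : ℂ)) :=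
        Complex.ofRealCLM.contDiff.comp (hg.comp (contDiff_const.sub contDiff_id))
      have h0 := congrArg (fun T : 𝓢'(Space d, ℂ) => T (hψ1.toSchwartzMap hψ2)) (hu j)
      simp only [lineDerivOp_apply_apply, Lp.toTemperedDistribution_apply] at h0
      rw [convolution_def]
      refine Eq.trans (integral_congr_ae (Filter.Eventually.of_forall fun t => ?_)) h0
      have hder : HasFDerivAt (fun t => (g (x₀ - t) : ℂ))
          (Complex.ofRealCLM.comp ((fderiv ℝ g (x₀ - t)).comp (-ContinuousLinearMap.id ℝ _))) t :=
        Complex.ofRealCLM.hasFDerivAt.comp t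
          (((hg1.differentiable one_ne_zero) (x₀ - t)).hasFDerivAt.comp t
            ((hasFDerivAt_id t).const_sub x₀))
      have hval : (-∂_{basisVec j} (hψ1.toSchwartzMap hψ2)) t
          = ((fderiv ℝ g (x₀ - t) (basisVec j) : ℝ) : ℂ) := by
        change -((∂_{basisVec j} (hψ1.toSchwartzMap hψ2)) t) = _
        rw [SchwartzMap.lineDerivOp_apply_eq_fderiv]
        have : fderiv ℝ (⇑(hψ1.toSchwartzMap hψ2)) t = _ := hder.fderiv
        rw [this]
        simp
      simp only [hval]
      simp [L]
    ext v
    have hb : ∑ j, v j • (basisVec j : Space d) = v := by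
      simpa using (EuclideanSpace.basisFun (Fin d) ℝ).sum_repr v
    rw [← hb, map_sum]
    simp only [map_smul, hz]
    simp
  have hconst := is_const_of_fderiv_eq_zero (𝕜 := ℝ) (f := u ⋆[L, volume] g)
    (fun x₀ => (hd x₀).differentiableAt) (fun x₀ => by rw [(hd x₀).fderiv, key]) x y
  simpa [convolution_def, L] using hconst

theorem eq_zero_of_grad_eq_zero [NeZero d] (hpt : p ≠ (⊤ : ℝ≥0∞))
    (u : Lp ℂ p (volume : Measure (Space d)))
    (hu : ∀ j : Fin d, ∂_{basisVec j} (u : 𝓢'(Space d, ℂ)) = 0) : u = 0 := by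
  rw [Lp.eq_zero_iff_ae_eq_zero]
  refine ae_eq_zero_of_integral_contDiff_smul_eq_zero
    ((Lp.memLp u).locallyIntegrable hp.out) fun g₀ hg₀ hgc₀ => ?_
  -- reflected test function
  have hg : ContDiff ℝ ∞ (fun t => g₀ (-t)) := hg₀.comp contDiff_neg
  have hgc : HasCompactSupport (fun t => g₀ (-t)) :=
    hgc₀.comp_homeomorph (Homeomorph.neg (Space d))
  set g : Space d → ℝ := fun t => g₀ (-t) with hgdef
  have h0 : ∫ t, g₀ t • u t = ∫ t, g (0 - t) • u t := by simp [hgdef]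
  rw [h0]
  have hpq := ENNReal.HolderConjugate.inv_one_sub_inv' hp.out
  set q : ℝ≥0∞ := (1 - p⁻¹)⁻¹ with hq
  have hgq : eLpNorm g q volume ≠ ⊤ :=
    (hg.continuous.memLp_of_hasCompactSupport hgc).eLpNorm_ne_top
  have hbound : ∀ ε : ℝ≥0∞, ε ≠ 0 → ‖∫ t, g (0 - t) • u t‖ₑ ≤ eLpNorm g q volume * ε := by
    intro ε hε
    obtain ⟨v, hvc, hv, hvcont, hvm⟩ :=
      (Lp.memLp u).exists_hasCompactSupport_eLpNorm_sub_le hpt hε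
    -- a point where the translated test function does not meet the support of `v`
    obtain ⟨x, hx⟩ : ∃ x : Space d, ∀ t, g (x - t) * ‖v t‖ = 0 := by
      obtain ⟨A, hA⟩ := hgc.isCompact.isBounded.exists_norm_le
      obtain ⟨B, hB⟩ := hvc.isCompact.isBounded.exists_norm_le
      refine ⟨EuclideanSpace.single 0 (|A| + |B| + 1), fun t => ?_⟩
      by_contra hne
      have hne' := mul_ne_zero_iff.mp hne
      have h1 := hA _ (subset_tsupport _ (Function.mem_support.mpr hne'.1))
      have h2 := hB _ (subset_tsupport _ (Function.mem_support.mpr (norm_ne_zero_iff.mp hne'.2)))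
      have h3 : ‖(EuclideanSpace.single 0 (|A| + |B| + 1) : Space d)‖ = |A| + |B| + 1 := by
        rw [PiLp.norm_single, Real.norm_eq_abs, abs_of_nonneg (by positivity)]
      have h4 := norm_add_le ((EuclideanSpace.single 0 (|A| + |B| + 1) : Space d) - t) t
      rw [sub_add_cancel, h3] at h4
      linarith [le_abs_self A, le_abs_self B]
    rw [integral_translate_const u hu g hg hgc 0 x]
    have hcongr : ∀ t, g (x - t) • u t = g (x - t) • (⇑u - v) t := by
      intro t
      have : g (x - t) • v t = 0 := by
        rcases mul_eq_zero.mp (hx t) with h | h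
        · simp [h]
        · simp [norm_eq_zero.mp h]
      rw [Pi.sub_apply, smul_sub, this, sub_zero]
    simp only [hcongr]
    refine (enorm_integral_le_lintegral_enorm _).trans ?_
    rw [← eLpNorm_one_eq_lintegral_enorm]
    have hqp : ENNReal.HolderTriple q p 1 := hpq.symm
    have hmeas : AEStronglyMeasurable (fun t => g (x - t)) (volume : Measure (Space d)) :=
      (hg.continuous.comp (continuous_const.sub continuous_id)).aestronglyMeasurable
    have hH := eLpNorm_smul_le_mul_eLpNorm (p := q) (q := p) (r := 1)
      ((Lp.memLp u).sub hvm).aestronglyMeasurable hmeas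
    refine hH.trans (mul_le_mul' (le_of_eq ?_) hv)
    exact eLpNorm_comp_measurePreserving (g := g) hg.continuous.aestronglyMeasurable
      (Measure.measurePreserving_sub_left volume x)
  rw [← enorm_eq_zero]
  by_contra hne
  have hpos : ‖∫ t, g (0 - t) • u t‖ₑ ≠ 0 := hne
  by_cases hgz : eLpNorm g q volume = 0
  · have := hbound 1 one_ne_zero
    rw [hgz, zero_mul] at this
    exact hpos (le_antisymm this zero_le)
  · have hfin : ‖∫ t, g (0 - t) • u t‖ₑ ≠ ⊤ := enorm_ne_top
    have hε : ‖∫ t, g (0 - t) • u t‖ₑ / (2 * eLpNorm g q volume) ≠ 0 :=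
      (ENNReal.div_pos hpos (ENNReal.mul_ne_top (by simp) hgq)).ne'
    have h1 := hbound _ hε
    have h2 : eLpNorm g q volume * (‖∫ t, g (0 - t) • u t‖ₑ / (2 * eLpNorm g q volume))
        = ‖∫ t, g (0 - t) • u t‖ₑ / 2 := by
      rw [mul_comm 2, ← ENNReal.mul_div_mul_left (‖∫ t, g (0 - t) • u t‖ₑ) 2 hgz hgq,
        mul_div_assoc]
    rw [h2] at h1
    exact absurd h1 (not_le.mpr (ENNReal.half_lt_self hpos hfin))

end Liouville

theorem eq_zero_of_mem_hdot {d : ℕ} [hd : Fact (3 ≤ d)] {u : 𝓢'(Space d, ℂ)} (hu : u ∈ hdot d)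
    (h : ∀ j : Fin d, ∂_{basisVec j} u = 0) : u = 0 := by
  obtain ⟨⟨f, rfl⟩, -⟩ := hu
  have : NeZero d := ⟨by have := hd.out; omega⟩
  rw [eq_zero_of_grad_eq_zero (p := sobolevExp d) ENNReal.ofReal_ne_top f h]
  exact map_zero (Lp.toTemperedDistributionCLM ℂ volume (sobolevExp d))

theorem inner_mulG {d : ℕ} (M : Medium d) (j k : Fin d) (f g : L2 d) :
    inner ℂ f (M.mulG j k g) = ∫ x, (M.G x j k : ℂ) * (g x * star (f x)) := by
  rw [L2.inner_def]
  refine integral_congr_ae ?_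
  filter_upwards [mulL2_coeFn _ (M.memLp_G j k) g] with x hx
  rw [Medium.mulG, hx, RCLike.inner_apply, starRingEnd_apply]
  ring

theorem integrable_mulG {d : ℕ} (M : Medium d) (j k : Fin d) (f g : L2 d) :
    Integrable (fun x => (M.G x j k : ℂ) * (g x * star (f x))) := by
  have h := L2.integrable_inner (𝕜 := ℂ) f (M.mulG j k g)
  refine h.congr ?_
  filter_upwards [mulL2_coeFn _ (M.memLp_G j k) g] with x hx
  rw [Medium.mulG, hx, RCLike.inner_apply, starRingEnd_apply]
  ring

theorem G_symm {d : ℕ} (M : Medium d) (x : Space d) (j k : Fin d) : M.G x j k = M.G x k j := by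
  have h := (M.G_posDef x).isHermitian.apply k j
  simpa using h

/-- The Hermitian form of `G(x)` on `ℂ^d`, through the real form. -/
theorem quad_eq {d : ℕ} (M : Medium d) (x : Space d) (w : Fin d → ℂ) :
    ∑ j, ∑ k, (M.G x j k : ℂ) * (w k * star (w j)) =
      (((fun j => (w j).re) ⬝ᵥ (M.G x).mulVec (fun j => (w j).re)
        + (fun j => (w j).im) ⬝ᵥ (M.G x).mulVec (fun j => (w j).im) : ℝ) : ℂ) := by
  apply Complex.ext
  · simp only [Complex.re_sum, Complex.ofReal_re, dotProduct, Matrix.mulVec, Finset.mul_sum,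
      ← Finset.sum_add_distrib]
    refine Finset.sum_congr rfl fun j _ => Finset.sum_congr rfl fun k _ => ?_
    simp
    ring
  · simp only [Complex.im_sum, Complex.ofReal_im]
    have hanti : ∑ j, ∑ k, ((M.G x j k : ℂ) * (w k * star (w j))).im
        = -∑ j, ∑ k, ((M.G x j k : ℂ) * (w k * star (w j))).im := by
      conv_rhs => rw [Finset.sum_comm]
      rw [← Finset.sum_neg_distrib]
      refine Finset.sum_congr rfl fun j _ => ?_
      rw [← Finset.sum_neg_distrib]
      refine Finset.sum_congr rfl fun k _ => ?_
      rw [G_symm M x k j]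
      simp
      ring
    linarith

theorem inner_sum_eq {d : ℕ} (M : Medium d) (F : Fin d → L2 d) :
    ∑ j, ∑ k, inner ℂ (F j) (M.mulG j k (F k)) =
      ((∫ x, ((fun j => (F j x).re) ⬝ᵥ (M.G x).mulVec (fun j => (F j x).re)
        + (fun j => (F j x).im) ⬝ᵥ (M.G x).mulVec (fun j => (F j x).im)) : ℝ) : ℂ) := by
  simp only [inner_mulG]
  refine Eq.trans ?_ integral_ofReal
  simp only [← integral_finsetSum Finset.univ (fun k _ => integrable_mulG M _ k _ _)]
  rw [← integral_finsetSum Finset.univ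
    (fun j _ => integrable_finsetSum Finset.univ (fun k _ => integrable_mulG M j k _ _))]
  exact integral_congr_ae (Filter.Eventually.of_forall fun x => quad_eq M x (fun j => F j x))

theorem quad_nonneg {d : ℕ} (M : Medium d) (x : Space d) (v : Fin d → ℝ) :
    0 ≤ v ⬝ᵥ (M.G x).mulVec v := by
  simpa using (M.G_posDef x).posSemidef.dotProduct_mulVec_nonneg v

theorem mulG_conj {d : ℕ} (M : Medium d) (j k : Fin d) (f g : L2 d) :
    star (inner ℂ g (M.mulG j k f)) = inner ℂ f (M.mulG k j g) := by
  rw [inner_mulG, inner_mulG, ← starRingEnd_apply, ← integral_conj]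
  refine integral_congr_ae (Filter.Eventually.of_forall fun x => ?_)
  simp [G_symm M x j k, mul_comm]

/-- The space `Ḣ¹`, which carries the norm `‖H₀^{1/2} u‖ = ⟨G ∇u, ∇u⟩^{1/2}` given by `G`. -/
def HDot {d : ℕ} [Fact (3 ≤ d)] (_ : Medium d) : Type := hdot d

section HDot

variable {d : ℕ} [Fact (3 ≤ d)] {M : Medium d}

instance : AddCommGroup (HDot M) := inferInstanceAs (AddCommGroup (hdot d))

instance : Module ℂ (HDot M) := inferInstanceAs (Module ℂ (hdot d))

/-- An element of `Ḣ¹`, as a distribution. -/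
def HDot.dist : HDot M →ₗ[ℂ] 𝓢'(Space d, ℂ) := (hdot d).subtype

theorem HDot.dist_mem (u : HDot M) : u.dist ∈ hdot d := u.property

theorem HDot.dist_injective : Function.Injective (HDot.dist : HDot M → 𝓢'(Space d, ℂ)) :=
  Subtype.val_injective

/-- The partial derivative `∂_j u ∈ L²` of `u ∈ Ḣ¹`. -/
def HDot.partialDeriv (j : Fin d) : HDot M →ₗ[ℂ] L2 d :=
  l2Rep d ∘ₗ LinearMap.codRestrict (LinearMap.range (l2Emb d))
    ((lineDerivOpCLM ℂ 𝓢'(Space d, ℂ) (basisVec j)).toLinearMap ∘ₗ HDot.dist)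
    (fun u => by
      obtain ⟨g, hg⟩ := u.dist_mem.2 j
      exact ⟨g, hg.symm⟩)

theorem HDot.partialDeriv_spec (j : Fin d) (u : HDot M) :
    (u.partialDeriv j : 𝓢'(Space d, ℂ)) = ∂_{basisVec j} u.dist :=
  l2Emb_l2Rep _

/-- The inner product `∑_{j,k} ∫ G_{jk} ∂_k w \overline{∂_j u}` on `Ḣ¹` (linear in `w`). -/
@[reducible]
def HDot.core : InnerProductSpace.Core ℂ (HDot M) where
  inner u w := ∑ j, ∑ k, inner ℂ (u.partialDeriv j) (M.mulG j k (w.partialDeriv k))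
  conj_inner_symm u w := by
    simp only [map_sum, starRingEnd_apply, mulG_conj]
    exact Finset.sum_comm
  re_inner_nonneg u := by
    rw [inner_sum_eq]
    change 0 ≤ (Complex.ofReal _).re
    rw [Complex.ofReal_re]
    exact integral_nonneg fun x => add_nonneg (quad_nonneg M x _) (quad_nonneg M x _)
  add_left u v w := by
    simp only [map_add, inner_add_left, Finset.sum_add_distrib]
  smul_left u w r := by
    simp only [map_smul, inner_smul_left, Finset.mul_sum]
  definite u hu := by
    change ∑ j, ∑ k, inner ℂ (u.partialDeriv j) (M.mulG j k (u.partialDeriv k)) = 0 at hu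
    have hint : Integrable (fun x => ∑ j, ∑ k, (M.G x j k : ℂ) *
        (u.partialDeriv k x * star (u.partialDeriv j x))) :=
      integrable_finsetSum _ fun j _ => integrable_finsetSum _ fun k _ =>
        integrable_mulG M j k _ _
    have hint' := (hint.congr (Filter.Eventually.of_forall fun x =>
      quad_eq M x (fun j => u.partialDeriv j x))).re
    simp only [RCLike.re_to_complex, Complex.ofReal_re] at hint'
    rw [inner_sum_eq, Complex.ofReal_eq_zero, integral_eq_zero_iff_of_nonneg
      (fun x => add_nonneg (quad_nonneg M x _) (quad_nonneg M x _)) hint'] at hu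
    have hz : ∀ j, u.partialDeriv j = 0 := by
      intro j
      rw [Lp.eq_zero_iff_ae_eq_zero]
      filter_upwards [hu] with x hx
      have hpos : ∀ v : Fin d → ℝ, v ⬝ᵥ (M.G x).mulVec v = 0 → v = 0 := by
        intro v hv
        by_contra hne
        have := (M.G_posDef x).dotProduct_mulVec_pos hne
        simp only [star_trivial] at this
        linarith
      have h1 := quad_nonneg M x (fun j => (u.partialDeriv j x).re)
      have h2 := quad_nonneg M x (fun j => (u.partialDeriv j x).im)
      simp only [Pi.zero_apply] at hx ⊢
      have e1 := hpos _ (by linarith : (fun j => (u.partialDeriv j x).re) ⬝ᵥ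
        (M.G x).mulVec (fun j => (u.partialDeriv j x).re) = 0)
      have e2 := hpos _ (by linarith : (fun j => (u.partialDeriv j x).im) ⬝ᵥ
        (M.G x).mulVec (fun j => (u.partialDeriv j x).im) = 0)
      exact Complex.ext (congrFun e1 j) (congrFun e2 j)
    apply HDot.dist_injective
    rw [map_zero]
    refine eq_zero_of_mem_hdot u.dist_mem fun j => ?_
    rw [← HDot.partialDeriv_spec, hz j]
    exact map_zero (l2Emb d)

instance : NormedAddCommGroup (HDot M) :=
  (HDot.core (M := M)).toNormedAddCommGroup

instance : InnerProductSpace ℂ (HDot M) :=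
  InnerProductSpace.ofCore (HDot.core (M := M)).toCore

theorem HDot.inner_eq (u w : HDot M) : inner ℂ u w =
    ∑ j, ∑ k, inner ℂ (u.partialDeriv j) (M.mulG j k (w.partialDeriv k)) := rfl

end HDot

/-! ### The energy space and the wave generator -/

section Wave

variable {d : ℕ} [Fact (3 ≤ d)]

/-- The energy space `ℋ = Ḣ¹ × L²`, with `‖(u,v)‖² = ⟨G ∇u, ∇u⟩ + ‖v‖²`. -/
abbrev Energy (M : Medium d) : Type := WithLp 2 (HDot M × L2 d)

/-- The wave generator `𝒜 = [[0, I], [H₀, -i a]]` on `ℋ`, with domain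
`{(u, v) ∈ ℋ | (v, H₀ u) ∈ ℋ}`, where `H₀ u` is taken in the sense of distributions. -/
def waveGen (M : Medium d) : Energy M →ₗ.[ℂ] Energy M where
  domain :=
    { carrier := {U | l2Emb d U.snd ∈ hdot d ∧ M.H0 U.fst.dist ∈ LinearMap.range (l2Emb d)}
      zero_mem' := by
        constructor
        · simp
        · simp
      add_mem' := by
        rintro U W ⟨h1, h2⟩ ⟨h3, h4⟩
        refine ⟨?_, ?_⟩
        · simpa using add_mem h1 h3
        · simpa using add_mem h2 h4
      smul_mem' := by
        rintro c U ⟨h1, h2⟩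
        refine ⟨?_, ?_⟩
        · simpa using (hdot d).smul_mem c h1
        · simpa using (LinearMap.range (l2Emb d)).smul_mem c h2 }
  toFun :=
    { toFun := fun U => WithLp.toLp 2
        ((⟨l2Emb d U.1.snd, U.2.1⟩ : hdot d),
          l2Rep d ⟨M.H0 U.1.fst.dist, U.2.2⟩ - Complex.I • M.mulA U.1.snd)
      map_add' := by
        intro U W
        refine WithLp.ofLp_injective 2 (Prod.ext (Subtype.ext ?_) ?_)
        · exact map_add (l2Emb d) U.1.snd W.1.snd
        · have h : (⟨M.H0 (U + W).1.fst.dist, (U + W).2.2⟩ : LinearMap.range (l2Emb d))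
              = ⟨M.H0 U.1.fst.dist, U.2.2⟩ + ⟨M.H0 W.1.fst.dist, W.2.2⟩ :=
            Subtype.ext (by simp)
          simp only [h, map_add]
          simp
          abel
      map_smul' := by
        intro c U
        refine WithLp.ofLp_injective 2 (Prod.ext (Subtype.ext ?_) ?_)
        · exact map_smul (l2Emb d) c U.1.snd
        · have h : (⟨M.H0 (c • U).1.fst.dist, (c • U).2.2⟩ : LinearMap.range (l2Emb d))
              = c • ⟨M.H0 U.1.fst.dist, U.2.2⟩ :=
            Subtype.ext (by simp)
          simp only [h, map_smul]
          simp [smul_sub, smul_comm c Complex.I] }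

theorem waveGen_fst_dist (M : Medium d) (U : (waveGen M).domain) :
    (waveGen M U).fst.dist = l2Emb d U.1.snd := rfl

theorem waveGen_snd (M : Medium d) (U : (waveGen M).domain) :
    l2Emb d (waveGen M U).snd = M.H0 U.1.fst.dist - l2Emb d (Complex.I • M.mulA U.1.snd) := by
  change l2Emb d (l2Rep d _ - Complex.I • M.mulA U.1.snd) = _
  rw [map_sub, l2Emb_l2Rep]

/-- The domain `𝒟(𝒜)`, which carries the norm `‖(u,v)‖_ℋ + ‖H₀ u‖ + ‖H₀^{1/2} v‖`. -/
def DomA (M : Medium d) : Type := (waveGen M).domain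

instance (M : Medium d) : AddCommGroup (DomA M) := inferInstanceAs (AddCommGroup (waveGen M).domain)

instance (M : Medium d) : Module ℂ (DomA M) := inferInstanceAs (Module ℂ (waveGen M).domain)

variable {M : Medium d}

/-- The inclusion of `𝒟(𝒜)` in `ℋ`. -/
def DomA.incl : DomA M →ₗ[ℂ] Energy M := (waveGen M).domain.subtype

/-- The wave generator, as a map on `𝒟(𝒜)`. -/
def DomA.gen : DomA M →ₗ[ℂ] Energy M := (waveGen M).toFun

/-- The function `H₀ u ∈ L²`, for `(u, v) ∈ 𝒟(𝒜)`. -/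
def DomA.h0 : DomA M →ₗ[ℂ] L2 d :=
  l2Rep d ∘ₗ LinearMap.codRestrict (LinearMap.range (l2Emb d))
    (M.H0.toLinearMap ∘ₗ HDot.dist ∘ₗ
      (WithLp.fstₗ 2 ℂ (HDot M) (L2 d)) ∘ₗ DomA.incl) (fun U => U.2.2)

/-- The component `v`, as an element of `Ḣ¹`, for `(u, v) ∈ 𝒟(𝒜)`. -/
def DomA.vHDot : DomA M →ₗ[ℂ] HDot M :=
  (LinearMap.codRestrict (hdot d)
    (l2Emb d ∘ₗ (WithLp.sndₗ 2 ℂ (HDot M) (L2 d)) ∘ₗ DomA.incl) (fun U => U.2.1) :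
      DomA M →ₗ[ℂ] hdot d)

theorem DomA.h0_spec (U : DomA M) : l2Emb d U.h0 = M.H0 U.incl.fst.dist := l2Emb_l2Rep _

theorem DomA.vHDot_spec (U : DomA M) : U.vHDot.dist = l2Emb d U.incl.snd := rfl

/-- The map `(u, v) ↦ ((u, v), H₀ u, v)` which gives the norm of `𝒟(𝒜)`. -/
def DomA.graphEmb : DomA M →ₗ[ℂ] WithLp 1 (Energy M × WithLp 1 (L2 d × HDot M)) :=
  (WithLp.linearEquiv 1 ℂ (Energy M × WithLp 1 (L2 d × HDot M))).symm.toLinearMap ∘ₗ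
    DomA.incl.prod ((WithLp.linearEquiv 1 ℂ (L2 d × HDot M)).symm.toLinearMap ∘ₗ
      DomA.h0.prod DomA.vHDot)

theorem DomA.graphEmb_injective : Function.Injective (DomA.graphEmb : DomA M →ₗ[ℂ] _) := by
  intro U W h
  exact Subtype.ext (congrArg (fun p => p.fst) h)

instance : NormedAddCommGroup (DomA M) :=
  NormedAddCommGroup.induced _ _ (DomA.graphEmb (M := M)) DomA.graphEmb_injective

instance : NormedSpace ℂ (DomA M) := NormedSpace.induced ℂ _ _ (DomA.graphEmb (M := M))

theorem DomA.norm_eq (U : DomA M) : ‖U‖ = ‖U.incl‖ + (‖U.h0‖ + ‖U.vHDot‖) := by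
  change ‖U.graphEmb‖ = _
  rw [WithLp.prod_norm_eq_of_L1, WithLp.prod_norm_eq_of_L1]
  rfl

/-! ### The matrix of resolvents -/

/-- A pair of Schwartz functions, as an element of `ℋ`. -/
def schwartzPair (M : Medium d) (f g : 𝓢(Space d, ℂ)) : Energy M :=
  WithLp.toLp 2 ((⟨(f : 𝓢'(Space d, ℂ)), schwartz_mem_hdot f⟩ : hdot d), g.toLp 2)

/-- `W ∈ 𝒟(𝒜)` is the product of the matrix
`[[R(z)(i a + z), R(z)], [I + R(z)(z i a + z²), z R(z)]]` and of the column `(f, g)`. -/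
def Medium.IsMatrixProduct (M : Medium d) (z : ℂ) (f g : 𝓢(Space d, ℂ)) (W : DomA M) : Prop :=
  let f' : L2 d := f.toLp 2
  let g' : L2 d := g.toLp 2
  W.incl.fst.dist = l2Emb d (M.R z (Complex.I • M.mulA f' + z • f') + M.R z g') ∧
  W.incl.snd = f' + M.R z ((z * Complex.I) • M.mulA f' + z ^ 2 • f') + z • M.R z g'

/-- The graph, in `ℋ × 𝒟(𝒜)`, of the operator which the matrix defines on `𝓢 × 𝓢`. -/
def Medium.matrixGraph (M : Medium d) (z : ℂ) : Set (Energy M × DomA M) :=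
  {p | ∃ f g : 𝓢(Space d, ℂ), p.1 = schwartzPair M f g ∧ M.IsMatrixProduct z f g p.2}

end Wave

/-! ### Dissipative operators -/

section Dissipative

variable {K : Type*} [NormedAddCommGroup K] [InnerProductSpace ℂ K]

/-- `T` is dissipative: `Im ⟨T φ, φ⟩ ≤ 0` on its domain. (The inner product of Mathlib is
antilinear in its first argument.) -/
def IsDissipative (T : K →ₗ.[ℂ] K) : Prop :=
  ∀ φ : T.domain, (inner ℂ (φ : K) (T φ)).im ≤ 0

/-- `T` is maximal dissipative: it is dissipative and is its only dissipative extension. -/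
def IsMaximalDissipative (T : K →ₗ.[ℂ] K) : Prop :=
  IsDissipative T ∧ ∀ S : K →ₗ.[ℂ] K, IsDissipative S → T ≤ S → S = T

end Dissipative

end DampedWave

end

open DampedWave

/-!
After preconditioning with the Bessel potential `J = (1 - Δ / (2π)²)⁻¹`, the operator
`H₀ - i z a - z²` becomes a bounded operator `S` on `L²`. The form `⟨S f, (1 + ν J) f⟩`,
multiplied by `i z̄`, is coercive for `ν` large: with `u = J f`, the pairing with `u` controls
`‖u‖_{H¹}` because `a ≥ 0` and `Im z > 0`, while the pairing with `Δ u` controls the Hessian up to a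
commutator which the first pairing absorbs. Hence `S` is invertible and `R(z) = J S⁻¹`.

On `ℋ`, Green's formula makes `𝒜` dissipative, and the graph of `𝒜` is closed because it is cut out
by two equations between distributions. By dissipativity, `𝒜 - z` is bounded below by `Im z`, so its
range is closed; it contains the dense space `𝓢 × 𝓢`, where `R(z)` solves the equation explicitly.
-/

noncomputable section

namespace DampedWave

/-! ### Estimates and operators in Hilbert spaces -/

section Hilbert

open Filter Topology

variable {𝕜 : Type*} [RCLike 𝕜]

theorem cauchySeq_comp_of_norm_le {E F G : Type*} [AddCommGroup E] [Module 𝕜 E]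
    [NormedAddCommGroup F] [NormedSpace 𝕜 F] [NormedAddCommGroup G] [NormedSpace 𝕜 G]
    {A : E →ₗ[𝕜] F} {B : E →ₗ[𝕜] G} {C : ℝ} (h : ∀ x, ‖A x‖ ≤ C * ‖B x‖) {x : ℕ → E}
    (hx : CauchySeq (B ∘ x)) : CauchySeq (A ∘ x) := by
  rw [cauchySeq_iff_tendsto_dist_atTop_0] at hx ⊢
  refine squeeze_zero (fun _ => dist_nonneg) (fun n => ?_) (by simpa using hx.const_mul C)
  simpa only [Function.comp_apply, dist_eq_norm, map_sub] using h (x n.1 - x n.2)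

theorem exists_tendsto_inner_sub_eq_zero {E H : Type*} [AddCommGroup E] [Module 𝕜 E]
    [NormedAddCommGroup H] [InnerProductSpace 𝕜 H] [CompleteSpace H] (e : E →ₗ[𝕜] H) (h : H) :
    ∃ (φ : ℕ → E) (w : H), Tendsto (e ∘ φ) atTop (𝓝 w) ∧ ∀ ψ, inner 𝕜 (e ψ) (h - w) = 0 := by
  set K : Submodule 𝕜 H := (LinearMap.range e).topologicalClosure
  have hK : IsClosed (K : Set H) := Submodule.isClosed_topologicalClosure _
  have : CompleteSpace K := hK.completeSpace_coe
  obtain ⟨x, hx, hxw⟩ := mem_closure_iff_seq_limit.mp (K.starProjection_apply_mem h)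
  choose φ hφ using hx
  refine ⟨φ, K.starProjection h, by simpa only [Function.comp_def, hφ] using hxw, fun ψ => ?_⟩
  exact Submodule.inner_right_of_mem_orthogonal
    (Submodule.le_topologicalClosure _ (LinearMap.mem_range_self e ψ))
    (K.sub_starProjection_mem_orthogonal h)

theorem isUnit_of_le_norm_inner_map_map {H : Type*} [NormedAddCommGroup H]
    [InnerProductSpace 𝕜 H] [CompleteSpace H] {S T : H →L[𝕜] H} {c : ℝ} (hc : 0 < c)
    (hS : IsUnit S) (hST : ∀ x, c * ‖x‖ ^ 2 ≤ ‖inner 𝕜 (S x) (T x)‖) : IsUnit T := by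
  have hprod : IsUnit (star S * T) := by
    refine ContinuousLinearMap.isUnit_of_forall_le_norm_inner_map _
      (Real.toNNReal_pos.mpr hc) fun x => ?_
    rw [norm_inner_symm, Real.coe_toNNReal c hc.le, mul_comm]
    exact (hST x).trans_eq (congrArg norm (ContinuousLinearMap.adjoint_inner_right S x _).symm)
  obtain ⟨v, hv⟩ := hS.star
  rw [← hv] at hprod
  exact (Units.isUnit_units_mul v _).mp hprod

theorem isUnit_one_add_smul {H : Type*} [NormedAddCommGroup H] [InnerProductSpace ℂ H]
    [CompleteSpace H] {B : H →L[ℂ] H} (hB : ∀ x, 0 ≤ (inner ℂ x (B x)).re) {ν : ℝ} (hν : 0 ≤ ν) :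
    IsUnit (1 + (ν : ℂ) • B) := by
  refine ContinuousLinearMap.isUnit_of_forall_le_norm_inner_map _ one_pos fun x => ?_
  have hre : (inner ℂ x ((1 + (ν : ℂ) • B) x)).re = ‖x‖ ^ 2 + ν * (inner ℂ x (B x)).re := by
    rw [add_apply, inner_add_right, smul_apply,
      inner_smul_right, Complex.add_re, Complex.re_ofReal_mul, norm_sq_eq_re_inner (𝕜 := ℂ) x]
    rfl
  rw [NNReal.coe_one, mul_one, norm_inner_symm]
  calc ‖x‖ ^ 2 ≤ ‖x‖ ^ 2 + ν * (inner ℂ x (B x)).re :=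
        le_add_of_nonneg_right (mul_nonneg hν (hB x))
    _ ≤ _ := hre.symm.trans_le (Complex.re_le_norm _)

end Hilbert

/-! ### Dissipative operators -/

section Dissipative

open Filter Topology

variable {K : Type*} [NormedAddCommGroup K] [InnerProductSpace ℂ K] {T : K →ₗ.[ℂ] K}

theorem im_inner_smul_self (z : ℂ) (x : K) : (inner ℂ x (z • x)).im = z.im * ‖x‖ ^ 2 := by
  rw [inner_smul_right, inner_self_eq_norm_sq_to_K, ← RCLike.ofReal_pow]
  exact Complex.im_mul_ofReal z _

theorem IsDissipative.im_mul_norm_le (hT : IsDissipative T) (z : ℂ) (φ : T.domain) :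
    z.im * ‖(φ : K)‖ ≤ ‖T φ - z • (φ : K)‖ := by
  rcases eq_or_lt_of_le (norm_nonneg (φ : K)) with h0 | h0
  · rw [← h0, mul_zero]
    exact norm_nonneg _
  refine le_of_mul_le_mul_right ?_ h0
  calc z.im * ‖(φ : K)‖ * ‖(φ : K)‖
      ≤ -(inner ℂ (φ : K) (T φ - z • (φ : K))).im := by
        rw [inner_sub_right, Complex.sub_im, im_inner_smul_self]
        linarith [hT φ]
    _ ≤ ‖inner ℂ (φ : K) (T φ - z • (φ : K))‖ :=
        (neg_le_abs _).trans (Complex.abs_im_le_norm _)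
    _ ≤ ‖(φ : K)‖ * ‖T φ - z • (φ : K)‖ := norm_inner_le_norm _ _
    _ = ‖T φ - z • (φ : K)‖ * ‖(φ : K)‖ := mul_comm _ _

theorem IsDissipative.injective_sub (hT : IsDissipative T) {z : ℂ} (hz : 0 < z.im) :
    Function.Injective fun φ : T.domain => T φ - z • (φ : K) := by
  intro φ ψ h
  have hle := hT.im_mul_norm_le z (φ - ψ)
  have hzero : T (φ - ψ) - z • ((φ - ψ : T.domain) : K) = 0 := by
    rw [LinearPMap.map_sub, Submodule.coe_sub, smul_sub, sub_sub_sub_comm]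
    exact sub_eq_zero.mpr h
  rw [hzero, norm_zero] at hle
  have hnorm := le_antisymm (nonpos_of_mul_nonpos_right hle hz) (norm_nonneg _)
  exact sub_eq_zero.mp (Subtype.ext (norm_eq_zero.mp hnorm))

theorem IsDissipative.surjective_sub [CompleteSpace K] (hT : IsDissipative T) (hcl : T.IsClosed)
    {z : ℂ} (hz : 0 < z.im) (hd : DenseRange fun φ : T.domain => T φ - z • (φ : K)) :
    Function.Surjective fun φ : T.domain => T φ - z • (φ : K) := by
  intro F
  obtain ⟨x, hx, hxF⟩ := mem_closure_iff_seq_limit.mp (hd F)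
  choose φ hφ using hx
  have hbound : ∀ ψ : T.domain, ‖T.domain.subtype ψ‖ ≤
      z.im⁻¹ * ‖(T.toFun - z • T.domain.subtype) ψ‖ := fun ψ => by
    rw [inv_mul_eq_div, le_div_iff₀ hz, mul_comm]
    exact hT.im_mul_norm_le z ψ
  have hcauchy : CauchySeq fun n => (φ n : K) :=
    cauchySeq_comp_of_norm_le hbound ((hxF.congr fun n => (hφ n).symm).cauchySeq)
  obtain ⟨V, hV⟩ := cauchySeq_tendsto_of_complete hcauchy
  have hTφ : Tendsto (fun n => T (φ n)) atTop (𝓝 (F + z • V)) :=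
    (hxF.add (hV.const_smul z)).congr fun n => by rw [← hφ, sub_add_cancel]
  have hmem : (V, F + z • V) ∈ T.graph :=
    hcl.mem_of_tendsto (hV.prodMk_nhds hTφ) (Eventually.of_forall fun n => T.mem_graph (φ n))
  obtain ⟨ψ, hψV, hψ⟩ := (LinearPMap.mem_graph_iff T).mp hmem
  exact ⟨ψ, (congrArg₂ (fun x y => x - z • y) hψ hψV).trans (add_sub_cancel_right F _)⟩

theorem IsDissipative.isMaximalDissipative (hT : IsDissipative T) {z : ℂ} (hz : 0 < z.im)
    (hsurj : Function.Surjective fun φ : T.domain => T φ - z • (φ : K)) :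
    IsMaximalDissipative T := by
  refine ⟨hT, fun S hS hle => (LinearPMap.eq_of_le_of_domain_eq hle
    (le_antisymm hle.1 fun φ hφ => ?_)).symm⟩
  obtain ⟨ψ, hψ⟩ := hsurj (S ⟨φ, hφ⟩ - z • φ)
  have hψS : S ⟨ψ, hle.1 ψ.2⟩ = T ψ := (hle.2 rfl).symm
  have heq : (⟨φ, hφ⟩ : S.domain) = ⟨ψ, hle.1 ψ.2⟩ :=
    hS.injective_sub hz (hψ.symm.trans (congrArg (· - z • (ψ : K)) hψS.symm))
  rw [show φ = ψ from congrArg Subtype.val heq]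
  exact ψ.2

end Dissipative

/-! ### The Sobolev inequality -/

section SobolevInequality

open Filter Topology Module
open scoped NNReal

variable {E F : Type*} [NormedAddCommGroup E] [NormedSpace ℝ E] [FiniteDimensional ℝ E]
  [NormedAddCommGroup F] [NormedSpace ℝ F] {u : E → F}

/-- The truncation `χ(x / (n + 1)) u(x)` of `u` to a ball of radius of order `n`, for a bump
function `χ` equal to `1` near the origin. -/
def truncate (χ : ContDiffBump (0 : E)) (n : ℕ) (u : E → F) (x : E) : F :=
  χ ((n + 1 : ℝ)⁻¹ • x) • u x

variable {χ : ContDiffBump (0 : E)}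

theorem contDiff_truncate {k : ℕ∞} (hu : ContDiff ℝ k u) (n : ℕ) :
    ContDiff ℝ k (truncate χ n u) :=
  (χ.contDiff.comp (contDiff_const_smul _)).smul hu

theorem hasCompactSupport_truncate (χ : ContDiffBump (0 : E)) (n : ℕ) (u : E → F) :
    HasCompactSupport (truncate χ n u) :=
  (χ.hasCompactSupport.comp_smul (by positivity)).smul_right

theorem tendsto_truncate (χ : ContDiffBump (0 : E)) (u : E → F) (x : E) :
    Tendsto (fun n => truncate χ n u x) atTop (𝓝 (u x)) := by
  have hx : Tendsto (fun n : ℕ => (n + 1 : ℝ)⁻¹ • x) atTop (𝓝 0) := by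
    simpa only [one_div, zero_smul] using
      (tendsto_one_div_add_atTop_nhds_zero_nat (𝕜 := ℝ)).smul_const x
  refine tendsto_const_nhds.congr' ?_
  filter_upwards [hx.eventually χ.eventuallyEq_one] with n hn
  rw [truncate, hn, Pi.one_apply, one_smul]

theorem exists_norm_fderiv_truncate_le (χ : ContDiffBump (0 : E)) :
    ∃ B : ℝ≥0, ∀ (n : ℕ) {u : E → F}, Differentiable ℝ u → ∀ x,
      ‖fderiv ℝ (truncate χ n u) x‖ ≤ ‖fderiv ℝ u x‖ + (n + 1 : ℝ)⁻¹ * B * ‖u x‖ := by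
  have hχ : ContDiff ℝ 1 χ := χ.contDiff
  obtain ⟨B, hB⟩ := (hχ.continuous_fderiv one_ne_zero).bounded_above_of_compact_support
    (χ.hasCompactSupport.fderiv ℝ)
  refine ⟨⟨B, (norm_nonneg _).trans (hB 0)⟩, fun n u hu x => ?_⟩
  have hχn := (hχ.differentiable one_ne_zero ((n + 1 : ℝ)⁻¹ • x)).hasFDerivAt.comp x
    ((hasFDerivAt_id x).const_smul (n + 1 : ℝ)⁻¹)
  have hn : (0 : ℝ) ≤ (n + 1 : ℝ)⁻¹ := by positivity
  rw [show fderiv ℝ (truncate χ n u) x = _ from (hχn.smul (hu x).hasFDerivAt).fderiv]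
  refine (norm_add_le _ _).trans (add_le_add ?_ ?_)
  · rw [norm_smul, Function.comp_apply, Real.norm_of_nonneg χ.nonneg]
    exact mul_le_of_le_one_left (norm_nonneg _) χ.le_one
  · rw [ContinuousLinearMap.norm_smulRight_apply, ContinuousLinearMap.comp_smul, norm_smul,
      Real.norm_of_nonneg hn]
    gcongr
    exact hB _

variable [MeasurableSpace E] [BorelSpace E]

/-- The inequality for compact supports passes to the limit: since `u ∈ L^p`, the derivative of the
cutoff contributes only `O(1/n)` to the norm of the derivative of the truncations. -/
theorem eLpNorm_le_eLpNorm_fderiv_of_memLp [FiniteDimensional ℝ F] (μ : Measure E)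
    [μ.IsAddHaarMeasure] (hu : ContDiff ℝ 1 u) {p p' : ℝ≥0} (hup : MemLp u p μ) (hp : 1 ≤ p)
    (hn : 0 < finrank ℝ E) (hp' : (p' : ℝ)⁻¹ = p⁻¹ - (finrank ℝ E : ℝ)⁻¹) :
    eLpNorm u p' μ ≤ SNormLESNormFDerivOfEqConst F μ p * eLpNorm (fderiv ℝ u) p μ := by
  let χ : ContDiffBump (0 : E) := default
  obtain ⟨B, hB⟩ := exists_norm_fderiv_truncate_le (F := F) χ
  have hfderiv : ∀ n : ℕ, eLpNorm (fderiv ℝ (truncate χ n u)) p μ ≤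
      eLpNorm (fderiv ℝ u) p μ + ENNReal.ofReal ((n + 1 : ℝ)⁻¹ * B) * eLpNorm u p μ := fun n => by
    refine (eLpNorm_mono_real (hB n (hu.differentiable one_ne_zero))).trans
      ((eLpNorm_add_le ?_ ?_ (by exact_mod_cast hp)).trans (add_le_add (by rw [eLpNorm_norm]) ?_))
    · exact (hu.continuous_fderiv one_ne_zero).norm.aestronglyMeasurable
    · exact (continuous_const.mul hu.continuous.norm).aestronglyMeasurable
    · refine eLpNorm_le_mul_eLpNorm_of_ae_le_mul (Eventually.of_forall fun x => ?_) p
      rw [norm_mul, norm_norm, Real.norm_of_nonneg (by positivity)]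
  have hε : Tendsto (fun n : ℕ => ENNReal.ofReal ((n + 1 : ℝ)⁻¹ * B)) atTop (𝓝 0) := by
    simpa [one_div] using ENNReal.tendsto_ofReal
      ((tendsto_one_div_add_atTop_nhds_zero_nat (𝕜 := ℝ)).mul_const (B : ℝ))
  have hlim : Tendsto (fun n : ℕ => (SNormLESNormFDerivOfEqConst F μ p : ℝ≥0∞) *
      (eLpNorm (fderiv ℝ u) p μ + ENNReal.ofReal ((n + 1 : ℝ)⁻¹ * B) * eLpNorm u p μ)) atTop
      (𝓝 (SNormLESNormFDerivOfEqConst F μ p * eLpNorm (fderiv ℝ u) p μ)) := by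
    simpa using ENNReal.Tendsto.const_mul (tendsto_const_nhds.add
      (ENNReal.Tendsto.mul_const hε (Or.inr hup.eLpNorm_ne_top))) (Or.inr ENNReal.coe_ne_top)
  calc eLpNorm u p' μ
      ≤ liminf (fun n => eLpNorm (truncate χ n u) p' μ) atTop :=
        Lp.eLpNorm_lim_le_liminf_eLpNorm
          (fun n => (contDiff_truncate hu n).continuous.aestronglyMeasurable) u
          (Eventually.of_forall (tendsto_truncate χ u))
    _ ≤ liminf (fun n : ℕ => (SNormLESNormFDerivOfEqConst F μ p : ℝ≥0∞) *
          (eLpNorm (fderiv ℝ u) p μ + ENNReal.ofReal ((n + 1 : ℝ)⁻¹ * B) * eLpNorm u p μ)) atTop :=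
        liminf_le_liminf (Eventually.of_forall fun n =>
          (eLpNorm_le_eLpNorm_fderiv_of_eq μ (contDiff_truncate hu n)
            (hasCompactSupport_truncate χ n u) hp hn hp').trans (mul_le_mul_right (hfderiv n) _))
    _ = _ := hlim.liminf_eq

end SobolevInequality

/-! ### Schwartz functions, square integrable functions and Fourier multipliers -/

section SchwartzFunctions

open Filter Topology
open scoped FourierTransform Laplacian Real

variable {d : ℕ} {p : ℝ≥0∞} [Fact (1 ≤ p)]

/-- A Schwartz function as an element of `L^p`. -/
def schwartzLp (d : ℕ) (p : ℝ≥0∞) [Fact (1 ≤ p)] :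
    𝓢(Space d, ℂ) →ₗ[ℂ] Lp ℂ p (volume : Measure (Space d)) :=
  (SchwartzMap.toLpCLM ℂ ℂ p volume).toLinearMap

/-- A Schwartz function as an element of `L²`. -/
abbrev schwartzL2 (d : ℕ) : 𝓢(Space d, ℂ) →ₗ[ℂ] L2 d := schwartzLp d 2

theorem toTemperedDistribution_schwartzLp (φ : 𝓢(Space d, ℂ)) :
    Lp.toTemperedDistributionCLM ℂ volume p (schwartzLp d p φ) = (φ : 𝓢'(Space d, ℂ)) :=
  Lp.toTemperedDistribution_toLp_eq φ

theorem l2Emb_schwartzL2 (φ : 𝓢(Space d, ℂ)) : l2Emb d (schwartzL2 d φ) = (φ : 𝓢'(Space d, ℂ)) :=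
  toTemperedDistribution_schwartzLp φ

theorem l2Emb_apply (h : L2 d) (ψ : 𝓢(Space d, ℂ)) : l2Emb d h ψ = ∫ x, ψ x * h x :=
  Lp.toTemperedDistribution_apply h ψ

theorem continuous_l2Emb : Continuous (l2Emb d) :=
  (Lp.toTemperedDistributionCLM ℂ (volume : Measure (Space d)) 2).continuous

theorem denseRange_schwartzL2 : DenseRange (schwartzL2 d) :=
  SchwartzMap.denseRange_toLpCLM (by simp)

/-- The complex conjugate of a Schwartz function. -/
def schwartzConj (φ : 𝓢(Space d, ℂ)) : 𝓢(Space d, ℂ) :=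
  SchwartzMap.postcompCLM (𝕜 := ℝ) (Complex.conjCLE : ℂ →L[ℝ] ℂ) φ

theorem schwartzConj_apply (φ : 𝓢(Space d, ℂ)) (x : Space d) :
    schwartzConj φ x = star (φ x) := rfl

theorem schwartzConj_schwartzConj (φ : 𝓢(Space d, ℂ)) : schwartzConj (schwartzConj φ) = φ := by
  ext x
  simp only [schwartzConj_apply, star_star]

theorem lineDerivOp_schwartzConj (m : Space d) (φ : 𝓢(Space d, ℂ)) :
    ∂_{m} (schwartzConj φ) = schwartzConj (∂_{m} φ) := by
  ext x
  have h : HasFDerivAt (schwartzConj φ)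
      ((Complex.conjCLE : ℂ →L[ℝ] ℂ).comp (fderiv ℝ φ x)) x :=
    (Complex.conjCLE : ℂ →L[ℝ] ℂ).hasFDerivAt.comp x (φ.hasFDerivAt x)
  rw [schwartzConj_apply, SchwartzMap.lineDerivOp_apply_eq_fderiv,
    SchwartzMap.lineDerivOp_apply_eq_fderiv, h.fderiv]
  rfl

theorem inner_schwartzL2 (φ : 𝓢(Space d, ℂ)) (h : L2 d) :
    inner ℂ (schwartzL2 d φ) h = l2Emb d h (schwartzConj φ) := by
  rw [L2.inner_def, l2Emb_apply]
  refine integral_congr_ae ?_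
  filter_upwards [φ.coeFn_toLp 2 volume] with x hx
  rw [show schwartzL2 d φ x = φ x from hx, RCLike.inner_apply, schwartzConj_apply,
    starRingEnd_apply, mul_comm]

theorem inner_schwartzL2_lineDerivOp (m : Space d) (φ : 𝓢(Space d, ℂ)) (g : L2 d) :
    inner ℂ (schwartzL2 d (∂_{m} φ)) g = -(∂_{m} (l2Emb d g)) (schwartzConj φ) := by
  rw [inner_schwartzL2, ← lineDerivOp_schwartzConj, TemperedDistribution.lineDerivOp_apply_apply,
    map_neg, neg_neg]

theorem laplacian_eq_sum_basisVec (T : 𝓢'(Space d, ℂ)) :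
    Δ T = ∑ j : Fin d, ∂_{basisVec j} (∂_{basisVec j} T) := by
  simpa only [EuclideanSpace.basisFun_apply] using
    TemperedDistribution.laplacian_eq_sum (EuclideanSpace.basisFun (Fin d) ℝ) T

theorem lineDerivOp_comm (v w : Space d) (T : 𝓢'(Space d, ℂ)) :
    ∂_{v} (∂_{w} T) = ∂_{w} (∂_{v} T) := by
  simp only [TemperedDistribution.lineDeriv_eq_fourierMultiplierCLM, map_smul]
  rw [TemperedDistribution.fourierMultiplierCLM_fourierMultiplierCLM_apply
      (by fun_prop) (by fun_prop),
    TemperedDistribution.fourierMultiplierCLM_fourierMultiplierCLM_apply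
      (by fun_prop) (by fun_prop), mul_comm fun x => ((inner ℝ x w : ℝ) : ℂ)]

theorem ae_eq_zero_of_smulLeftCLM_eq_zero {m : Space d → ℂ} (hm : m.HasTemperateGrowth) {f : L2 d}
    (h : TemperedDistribution.smulLeftCLM ℂ m (l2Emb d f) = 0) :
    (fun x => m x * f x) =ᵐ[volume] 0 := by
  refine ae_eq_zero_of_integral_contDiff_smul_eq_zero ?_ fun g hg hgc => ?_
  · have hf := (Lp.memLp f).locallyIntegrable one_le_two
    exact locallyIntegrableOn_univ.mp ((hf.locallyIntegrableOn Set.univ).continuousOn_mul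
      hm.1.continuous.continuousOn isOpen_univ.isLocallyClosed)
  · have hgc' : HasCompactSupport (Complex.ofRealCLM ∘ g) := hgc.comp_left rfl
    have hg' : ContDiff ℝ ∞ (Complex.ofRealCLM ∘ g) := by fun_prop
    have hint := congrArg (fun T : 𝓢'(Space d, ℂ) => T (hgc'.toSchwartzMap hg')) h
    simp only [TemperedDistribution.smulLeftCLM_apply_apply, l2Emb_apply] at hint
    refine Eq.trans (integral_congr_ae (Eventually.of_forall fun x => ?_)) hint
    simp only [SchwartzMap.smulLeftCLM_apply_apply hm]
    change (g x : ℝ) • (m x * f x) = m x * (g x : ℂ) * f x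
    rw [Complex.real_smul]
    ring

theorem eq_zero_of_fourierMultiplierCLM_eq_zero {m : Space d → ℂ} (hm : m.HasTemperateGrowth)
    (hm0 : ∀ᵐ x, m x ≠ 0) {f : L2 d}
    (h : TemperedDistribution.fourierMultiplierCLM ℂ m (l2Emb d f) = 0) : f = 0 := by
  have hmul : TemperedDistribution.smulLeftCLM ℂ m (l2Emb d (𝓕 f)) = 0 := by
    have hf : (𝓕 (l2Emb d f) : 𝓢'(Space d, ℂ)) = l2Emb d (𝓕 f) :=
      Lp.fourier_toTemperedDistribution_eq f
    rw [TemperedDistribution.fourierMultiplierCLM_apply, hf] at h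
    rw [← FourierTransform.fourier_fourierInv_eq (E := 𝓢'(Space d, ℂ)) (F := 𝓢'(Space d, ℂ))
      (TemperedDistribution.smulLeftCLM ℂ m _), h]
    exact map_zero (FourierTransform.fourierCLM ℂ 𝓢'(Space d, ℂ))
  have hf : (𝓕 f : L2 d) = 0 := by
    rw [Lp.eq_zero_iff_ae_eq_zero]
    filter_upwards [ae_eq_zero_of_smulLeftCLM_eq_zero hm hmul, hm0] with x hx hx0
    exact (mul_eq_zero.mp hx).resolve_left hx0
  rw [← norm_eq_zero, ← Lp.norm_fourier_eq, hf, norm_zero]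

theorem fourierMultiplierCLM_add_mul_norm_sq (c b : ℝ) (T : 𝓢'(Space d, ℂ)) :
    TemperedDistribution.fourierMultiplierCLM ℂ
      (fun x : Space d => ((c + b * ‖x‖ ^ 2 : ℝ) : ℂ)) T =
        (c : ℂ) • T - ((((2 * π) ^ 2)⁻¹ * b : ℝ) : ℂ) • Δ T := by
  have hsq : (fun x : Space d => ((‖x‖ ^ 2 : ℝ) : ℂ)).HasTemperateGrowth := by fun_prop
  have hsq' : ((b : ℂ) • fun x : Space d => ((‖x‖ ^ 2 : ℝ) : ℂ)).HasTemperateGrowth := by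
    change (fun x : Space d => (b : ℂ) • ((‖x‖ ^ 2 : ℝ) : ℂ)).HasTemperateGrowth
    fun_prop
  have hsum : (fun x : Space d => ((c + b * ‖x‖ ^ 2 : ℝ) : ℂ)) =
      (fun _ => (c : ℂ)) + (b : ℂ) • fun x => ((‖x‖ ^ 2 : ℝ) : ℂ) := by
    ext x
    simp
  have hπ : (π : ℂ) ≠ 0 := Complex.ofReal_ne_zero.mpr Real.pi_ne_zero
  rw [hsum, TemperedDistribution.fourierMultiplierCLM_apply,
    TemperedDistribution.smulLeftCLM_add (by fun_prop) hsq',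
    TemperedDistribution.smulLeftCLM_smul hsq, add_apply, smul_apply,
    TemperedDistribution.smulLeftCLM_const, FourierTransform.fourierInv_add,
    FourierTransform.fourierInv_smul, FourierTransform.fourierInv_smul,
    FourierTransform.fourierInv_fourier_eq, ← TemperedDistribution.fourierMultiplierCLM_apply,
    TemperedDistribution.laplacian_eq_fourierMultiplierCLM, ← Complex.coe_smul, smul_smul,
    sub_eq_add_neg, ← neg_smul]
  congr 2
  push_cast
  field_simp

theorem eq_zero_of_laplacian_eq_smul [NeZero d] {κ : ℝ} (hκ : 0 ≤ κ) {f : L2 d}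
    (h : Δ (l2Emb d f) = (κ : ℂ) • l2Emb d f) : f = 0 := by
  have hne : ∀ᵐ x : Space d, ((κ + (2 * π) ^ 2 * ‖x‖ ^ 2 : ℝ) : ℂ) ≠ 0 := by
    filter_upwards [Measure.ae_ne volume (0 : Space d)] with x hx
    have : 0 < ‖x‖ := norm_pos_iff.mpr hx
    exact Complex.ofReal_ne_zero.mpr (by positivity)
  refine eq_zero_of_fourierMultiplierCLM_eq_zero (by fun_prop) hne ?_
  rw [fourierMultiplierCLM_add_mul_norm_sq, h, inv_mul_cancel₀ (by positivity), Complex.ofReal_one,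
    one_smul, sub_self]

end SchwartzFunctions

/-! ### Gradients of Schwartz functions -/

section Gradient

open Filter Topology
open scoped Laplacian

variable {d : ℕ}

/-- The Hilbert space of square integrable vector fields. -/
abbrev VectorL2 (d : ℕ) : Type := PiLp 2 (fun _ : Fin d => L2 d)

/-- The gradient of a Schwartz function, in `L²`. -/
def schwartzGrad (d : ℕ) : 𝓢(Space d, ℂ) →ₗ[ℂ] VectorL2 d :=
  (WithLp.linearEquiv 2 ℂ (Fin d → L2 d)).symm.toLinearMap ∘ₗ
    LinearMap.pi fun j => schwartzL2 d ∘ₗ (lineDerivOpCLM ℂ 𝓢(Space d, ℂ) (basisVec j)).toLinearMap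

theorem schwartzGrad_apply (φ : 𝓢(Space d, ℂ)) (j : Fin d) :
    schwartzGrad d φ j = schwartzL2 d (∂_{basisVec j} φ) := rfl

/-- The pair of a Schwartz function and of its gradient: the embedding which defines `H¹`. -/
def schwartzJet (d : ℕ) : 𝓢(Space d, ℂ) →ₗ[ℂ] WithLp 2 (L2 d × VectorL2 d) :=
  (WithLp.linearEquiv 2 ℂ (L2 d × VectorL2 d)).symm.toLinearMap ∘ₗ
    (schwartzL2 d).prod (schwartzGrad d)

theorem inner_schwartzGrad (φ : 𝓢(Space d, ℂ)) {g : VectorL2 d} {T : 𝓢'(Space d, ℂ)}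
    (hT : ∀ j, ∂_{basisVec j} T = l2Emb d (g j)) :
    inner ℂ (schwartzGrad d φ) g = -(Δ T) (schwartzConj φ) := by
  rw [PiLp.inner_apply, laplacian_eq_sum_basisVec]
  simp only [schwartzGrad_apply, inner_schwartzL2_lineDerivOp, hT, Finset.sum_neg_distrib]
  exact congrArg Neg.neg (sum_apply _ _ _).symm

theorem lineDerivOp_eq_of_tendsto {p : ℝ≥0∞} [Fact (1 ≤ p)] {φ : ℕ → 𝓢(Space d, ℂ)}
    {f : Lp ℂ p (volume : Measure (Space d))} {g : VectorL2 d}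
    (hf : Tendsto (schwartzLp d p ∘ φ) atTop (𝓝 f))
    (hg : Tendsto (schwartzGrad d ∘ φ) atTop (𝓝 g)) (j : Fin d) :
    ∂_{basisVec j} (f : 𝓢'(Space d, ℂ)) = l2Emb d (g j) := by
  have hleft : Tendsto (fun n => ∂_{basisVec j} (φ n : 𝓢'(Space d, ℂ))) atTop
      (𝓝 (∂_{basisVec j} (f : 𝓢'(Space d, ℂ)))) := by
    have hcont := ((lineDerivOpCLM ℂ 𝓢'(Space d, ℂ) (basisVec j)).continuous.comp
      (Lp.toTemperedDistributionCLM ℂ (volume : Measure (Space d)) p).continuous).tendsto f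
    exact (hcont.comp hf).congr fun n =>
      congrArg (∂_{basisVec j} ·) (toTemperedDistribution_schwartzLp (φ n))
  have hright : Tendsto (fun n => ∂_{basisVec j} (φ n : 𝓢'(Space d, ℂ))) atTop
      (𝓝 (l2Emb d (g j))) := by
    refine ((continuous_l2Emb.tendsto (g j)).comp
      (((PiLp.continuous_apply 2 _ j).tendsto g).comp hg)).congr fun n => ?_
    simp only [Function.comp_apply, schwartzGrad_apply, l2Emb_schwartzL2,
      lineDerivOp_toTemperedDistributionCLM_eq]
  exact tendsto_nhds_unique hleft hright

theorem norm_le_sum_norm_apply_basis {ι E F : Type*} [Fintype ι]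
    [NormedAddCommGroup E] [InnerProductSpace ℝ E] [NormedAddCommGroup F] [NormedSpace ℝ F]
    (b : OrthonormalBasis ι ℝ E) (A : E →L[ℝ] F) : ‖A‖ ≤ ∑ j, ‖A (b j)‖ := by
  refine A.opNorm_le_bound (by positivity) fun v => ?_
  conv_lhs => rw [← b.sum_repr v, map_sum]
  refine (norm_sum_le _ _).trans ?_
  rw [Finset.sum_mul]
  gcongr with j
  rw [map_smul, norm_smul, mul_comm]
  gcongr
  exact (PiLp.norm_apply_le (b.repr v) j).trans_eq (b.repr.norm_map v)

theorem eLpNorm_fderiv_schwartz_le (φ : 𝓢(Space d, ℂ)) :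
    eLpNorm (fderiv ℝ φ) 2 volume ≤ ENNReal.ofReal (d * ‖schwartzGrad d φ‖) := by
  have hpartial : ∀ j : Fin d, eLpNorm (∂_{basisVec j} φ : 𝓢(Space d, ℂ)) 2 volume ≤
      ENNReal.ofReal ‖schwartzGrad d φ‖ := fun j => by
    rw [← ENNReal.ofReal_toReal (MemLp.eLpNorm_ne_top ((∂_{basisVec j} φ).memLp 2 volume)),
      ← SchwartzMap.norm_toLp]
    exact ENNReal.ofReal_le_ofReal (PiLp.norm_apply_le (schwartzGrad d φ) j)
  calc eLpNorm (fderiv ℝ φ) 2 volume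
      ≤ eLpNorm (∑ j : Fin d, fun x => ‖(∂_{basisVec j} φ : 𝓢(Space d, ℂ)) x‖) 2 volume := by
        refine eLpNorm_mono_real fun x => ?_
        simpa only [Finset.sum_apply, SchwartzMap.lineDerivOp_apply_eq_fderiv,
          EuclideanSpace.basisFun_apply] using
          norm_le_sum_norm_apply_basis (EuclideanSpace.basisFun (Fin d) ℝ) (fderiv ℝ φ x)
    _ ≤ ∑ j : Fin d, eLpNorm (∂_{basisVec j} φ : 𝓢(Space d, ℂ)) 2 volume := by
        refine (eLpNorm_sum_le (fun j _ => ?_) one_le_two).trans_eq (by simp only [eLpNorm_norm])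
        exact (∂_{basisVec j} φ).continuous.norm.aestronglyMeasurable
    _ ≤ ∑ _j : Fin d, ENNReal.ofReal ‖schwartzGrad d φ‖ := Finset.sum_le_sum fun j _ => hpartial j
    _ = ENNReal.ofReal (d * ‖schwartzGrad d φ‖) := by
        rw [Finset.sum_const, Finset.card_univ, Fintype.card_fin, nsmul_eq_mul,
          ENNReal.ofReal_mul (Nat.cast_nonneg d), ENNReal.ofReal_natCast]

theorem exists_norm_schwartzLp_le (d : ℕ) [hd : Fact (3 ≤ d)] : ∃ C : ℝ, ∀ φ : 𝓢(Space d, ℂ),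
    ‖schwartzLp d (sobolevExp d) φ‖ ≤ C * ‖schwartzGrad d φ‖ := by
  have hd3 : (3 : ℝ) ≤ d := by exact_mod_cast hd.out
  have hfin : 0 < Module.finrank ℝ (Space d) := by
    rw [finrank_euclideanSpace_fin]
    have := hd.out
    omega
  have hexp : ((Real.toNNReal (2 * d / (d - 2)) : NNReal) : ℝ)⁻¹ =
      ((2 : NNReal) : ℝ)⁻¹ - (Module.finrank ℝ (Space d) : ℝ)⁻¹ := by
    rw [Real.coe_toNNReal _ (div_nonneg (by positivity) (by linarith)), finrank_euclideanSpace_fin]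
    have : (d : ℝ) - 2 ≠ 0 := by linarith
    push_cast
    field_simp
  refine ⟨SNormLESNormFDerivOfEqConst ℂ (volume : Measure (Space d)) (2 : NNReal) * d,
    fun φ => ?_⟩
  have hsob := eLpNorm_le_eLpNorm_fderiv_of_memLp volume ((φ.smooth ⊤).of_le (by simp))
    (φ.memLp (2 : NNReal) volume) one_le_two hfin hexp
  rw [show ‖schwartzLp d (sobolevExp d) φ‖ = (eLpNorm φ (sobolevExp d) volume).toReal from
    SchwartzMap.norm_toLp, mul_assoc]
  refine ENNReal.toReal_le_of_le_ofReal (by positivity) (hsob.trans ?_)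
  rw [ENNReal.ofReal_mul NNReal.zero_le_coe, ENNReal.ofReal_coe_nnreal]
  gcongr
  exact eLpNorm_fderiv_schwartz_le φ

theorem exists_hdot_of_tendsto_schwartzGrad (d : ℕ) [Fact (3 ≤ d)] :
    ∃ C : ℝ, ∀ {φ : ℕ → 𝓢(Space d, ℂ)} {g : VectorL2 d},
      Tendsto (schwartzGrad d ∘ φ) atTop (𝓝 g) →
      ∃ f : Lp ℂ (sobolevExp d) (volume : Measure (Space d)),
        Tendsto (schwartzLp d (sobolevExp d) ∘ φ) atTop (𝓝 f) ∧ ‖f‖ ≤ C * ‖g‖ := by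
  obtain ⟨C, hC⟩ := exists_norm_schwartzLp_le d
  refine ⟨C, fun hg => ?_⟩
  obtain ⟨f, hf⟩ := cauchySeq_tendsto_of_complete (cauchySeq_comp_of_norm_le hC hg.cauchySeq)
  exact ⟨f, hf, le_of_tendsto_of_tendsto' hf.norm (hg.norm.const_mul C) fun n => hC _⟩

theorem exists_schwartzGrad_tendsto [hd : Fact (3 ≤ d)] {u : 𝓢'(Space d, ℂ)} {g : VectorL2 d}
    (hg : ∀ j, ∂_{basisVec j} u = l2Emb d (g j)) :
    ∃ φ : ℕ → 𝓢(Space d, ℂ), Tendsto (schwartzGrad d ∘ φ) atTop (𝓝 g) := by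
  have : NeZero d := ⟨by have := hd.out; omega⟩
  obtain ⟨φ, w, hw, horth⟩ := exists_tendsto_inner_sub_eq_zero (schwartzGrad d) g
  obtain ⟨C, hC⟩ := exists_hdot_of_tendsto_schwartzGrad d
  obtain ⟨f, hf, -⟩ := hC hw
  have hgrad : ∀ j, ∂_{basisVec j} (u - (f : 𝓢'(Space d, ℂ))) = l2Emb d ((g - w) j) := fun j => by
    rw [sub_eq_add_neg, lineDerivOp_add, lineDerivOp_neg, hg, lineDerivOp_eq_of_tendsto hf hw,
      ← sub_eq_add_neg, ← map_sub, PiLp.sub_apply]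
  have hharm : Δ (u - (f : 𝓢'(Space d, ℂ))) = 0 := by
    ext ψ
    have h := inner_schwartzGrad (schwartzConj ψ) hgrad
    rw [horth, schwartzConj_schwartzConj] at h
    exact neg_eq_zero.mp h.symm
  have hzero : g - w = 0 := by
    refine PiLp.ext fun j => eq_zero_of_laplacian_eq_smul (κ := 0) le_rfl ?_
    have hcomm : Δ (∂_{basisVec j} (u - (f : 𝓢'(Space d, ℂ)))) = 0 := by
      simp only [laplacian_eq_sum_basisVec, fun i => lineDerivOp_comm (basisVec i) (basisVec j)]
      rw [← lineDerivOp_sum, ← laplacian_eq_sum_basisVec, hharm, lineDerivOp_zero]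
    rw [← hgrad, hcomm, hgrad, ← map_smul, Complex.ofReal_zero, zero_smul, map_zero]
  exact ⟨φ, by rwa [sub_eq_zero.mp hzero]⟩

theorem exists_schwartzL2_schwartzGrad_tendsto [NeZero d] {v : L2 d} {g : VectorL2 d}
    (hg : ∀ j, ∂_{basisVec j} (l2Emb d v) = l2Emb d (g j)) :
    ∃ φ : ℕ → 𝓢(Space d, ℂ), Tendsto (schwartzL2 d ∘ φ) atTop (𝓝 v) ∧
      Tendsto (schwartzGrad d ∘ φ) atTop (𝓝 g) := by
  obtain ⟨φ, w, hw, horth⟩ :=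
    exists_tendsto_inner_sub_eq_zero (schwartzJet d) (WithLp.toLp 2 (v, g))
  have hfst : Tendsto (schwartzL2 d ∘ φ) atTop (𝓝 w.fst) :=
    ((WithLp.prod_continuous_ofLp 2 _ _).fst.tendsto w).comp hw
  have hsnd : Tendsto (schwartzGrad d ∘ φ) atTop (𝓝 w.snd) :=
    ((WithLp.prod_continuous_ofLp 2 _ _).snd.tendsto w).comp hw
  have hgrad : ∀ j, ∂_{basisVec j} (l2Emb d (v - w.fst)) = l2Emb d ((g - w.snd) j) := fun j => by
    rw [map_sub, sub_eq_add_neg, lineDerivOp_add, lineDerivOp_neg, hg,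
      show ∂_{basisVec j} (l2Emb d w.fst) = _ from lineDerivOp_eq_of_tendsto hfst hsnd j,
      ← sub_eq_add_neg, ← map_sub, PiLp.sub_apply]
  have hv : v - w.fst = 0 := by
    refine eq_zero_of_laplacian_eq_smul (κ := 1) zero_le_one ?_
    rw [Complex.ofReal_one, one_smul]
    ext ψ
    have h : inner ℂ (schwartzL2 d (schwartzConj ψ)) (v - w.fst) +
        inner ℂ (schwartzGrad d (schwartzConj ψ)) (g - w.snd) = 0 := horth (schwartzConj ψ)
    rw [inner_schwartzL2, inner_schwartzGrad _ hgrad, schwartzConj_schwartzConj] at h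
    exact (add_neg_eq_zero.mp h).symm
  have hg' : g - w.snd = 0 := by
    refine PiLp.ext fun j => l2Emb_injective d ?_
    rw [← hgrad, hv, PiLp.zero_apply, map_zero, lineDerivOp_zero]
  exact ⟨φ, by rwa [sub_eq_zero.mp hv], by rwa [sub_eq_zero.mp hg']⟩

theorem mem_hdot_of_lineDerivOp_eq [hd : Fact (3 ≤ d)] {v : L2 d} {g : VectorL2 d}
    (hg : ∀ j, ∂_{basisVec j} (l2Emb d v) = l2Emb d (g j)) : l2Emb d v ∈ hdot d := by
  have : NeZero d := ⟨by have := hd.out; omega⟩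
  obtain ⟨C, hC⟩ := exists_hdot_of_tendsto_schwartzGrad d
  obtain ⟨φ, hφ, hgrad⟩ := exists_schwartzL2_schwartzGrad_tendsto hg
  obtain ⟨f, hf, -⟩ := hC hgrad
  have hf' := ((Lp.toTemperedDistributionCLM ℂ (volume : Measure (Space d))
    (sobolevExp d)).continuous.tendsto f).comp hf
  refine ⟨⟨f, tendsto_nhds_unique ((continuous_l2Emb.tendsto v).comp hφ) (hf'.congr fun n => ?_)⟩,
    fun j => ⟨g j, hg j⟩⟩
  simp only [Function.comp_apply, toTemperedDistribution_schwartzLp, l2Emb_schwartzL2]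

end Gradient

/-! ### Ellipticity -/

section Ellipticity

open Filter Topology
open scoped Matrix

variable {d : ℕ}

theorem abs_dotProduct_mulVec_le {ι : Type*} [Fintype ι] {A : Matrix ι ι ℝ} {ε : ℝ}
    (hA : ∀ i j, |A i j| ≤ ε) (v : ι → ℝ) :
    |v ⬝ᵥ A *ᵥ v| ≤ ε * Fintype.card ι * (v ⬝ᵥ v) := by
  have hterm : ∀ i j, |v i * (A i j * v j)| ≤ ε * ((v i * v i + v j * v j) / 2) := fun i j => by
    rw [show v i * (A i j * v j) = A i j * (v i * v j) by ring, abs_mul]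
    refine mul_le_mul (hA i j) ?_ (abs_nonneg _) ((abs_nonneg _).trans (hA i j))
    exact abs_le.mpr ⟨by nlinarith [sq_nonneg (v i + v j)], by nlinarith [sq_nonneg (v i - v j)]⟩
  calc |v ⬝ᵥ A *ᵥ v| ≤ ∑ i, ∑ j, |v i * (A i j * v j)| := by
        simp only [dotProduct, Matrix.mulVec, Finset.mul_sum]
        exact (Finset.abs_sum_le_sum_abs _ _).trans
          (Finset.sum_le_sum fun i _ => Finset.abs_sum_le_sum_abs _ _)
    _ ≤ ∑ i, ∑ j, ε * ((v i * v i + v j * v j) / 2) :=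
        Finset.sum_le_sum fun i _ => Finset.sum_le_sum fun j _ => hterm i j
    _ = ε * Fintype.card ι * (v ⬝ᵥ v) := by
        simp only [← Finset.mul_sum, ← Finset.sum_div, Finset.sum_add_distrib, Finset.sum_const,
          Finset.card_univ, mul_smul_comm, Finset.sum_nsmul, dotProduct]
        rw [nsmul_eq_mul]
        ring

theorem exists_pos_forall_le_dotProduct_mulVec {X ι : Type*} [TopologicalSpace X] [Fintype ι]
    {K : Set X} (hK : IsCompact K) {A : X → Matrix ι ι ℝ} (hA : Continuous A)
    (hpos : ∀ x ∈ K, (A x).PosDef) :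
    ∃ m > 0, ∀ x ∈ K, ∀ v, m * (v ⬝ᵥ v) ≤ v ⬝ᵥ A x *ᵥ v := by
  obtain ⟨m, hm, hle⟩ := (hK.prod (isCompact_sphere (0 : EuclideanSpace ℝ ι) 1)).exists_forall_le'
    (f := fun p => p.2.ofLp ⬝ᵥ A p.1 *ᵥ p.2.ofLp) (a := 0) (by fun_prop) fun p hp => by
      have hne : p.2.ofLp ≠ 0 := fun h => by
        simpa [(WithLp.ofLp_eq_zero 2).mp h] using hp.2
      simpa only [star_trivial] using (hpos p.1 hp.1).dotProduct_mulVec_pos hne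
  refine ⟨m, hm, fun x hx v => ?_⟩
  have hnorm : v ⬝ᵥ v = ‖WithLp.toLp 2 v‖ ^ 2 := by
    rw [EuclideanSpace.real_norm_sq_eq]
    simp only [dotProduct, sq]
  rcases eq_or_ne v 0 with rfl | hv
  · simp only [zero_dotProduct, mul_zero, le_refl]
  have hv' : 0 < ‖WithLp.toLp 2 v‖ := norm_pos_iff.mpr ((WithLp.toLp_eq_zero 2).not.mpr hv)
  have h := hle (x, ‖WithLp.toLp 2 v‖⁻¹ • WithLp.toLp 2 v)
    ⟨hx, by simp [norm_smul, hv'.ne']⟩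
  simp only [WithLp.ofLp_smul, Matrix.mulVec_smul, smul_dotProduct, dotProduct_smul,
    smul_eq_mul] at h
  rw [hnorm, ← le_div_iff₀ (by positivity)]
  exact h.trans_eq (by field_simp)

theorem tendsto_bracket_cocompact : Tendsto (bracket (d := d)) (cocompact _) atTop :=
  tendsto_atTop_mono (fun _ => Real.le_sqrt_of_sq_le (by linarith)) tendsto_norm_cocompact_atTop

theorem tendsto_zero_of_norm_le_bracket_rpow {f : Space d → ℝ} {c s : ℝ} (hs : 0 < s)
    (hf : ∀ x, ‖f x‖ ≤ c * bracket x ^ (-s)) : Tendsto f (cocompact _) (𝓝 0) :=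
  squeeze_zero_norm hf <| by
    simpa only [mul_zero, Function.comp_def] using
      ((tendsto_rpow_neg_atTop hs).comp tendsto_bracket_cocompact).const_mul c

/-- The operator on the square integrable vector fields which has the matrix `B`. -/
def matrixOperator (B : Fin d → Fin d → L2 d →L[ℂ] L2 d) : VectorL2 d →L[ℂ] VectorL2 d :=
  (PiLp.continuousLinearEquiv 2 ℂ fun _ : Fin d => L2 d).symm.toContinuousLinearMap ∘L
    ContinuousLinearMap.pi fun j => ∑ k, B j k ∘L PiLp.proj 2 (fun _ : Fin d => L2 d) k

theorem inner_matrixOperator (B : Fin d → Fin d → L2 d →L[ℂ] L2 d) (E F : VectorL2 d) :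
    inner ℂ E (matrixOperator B F) = ∑ j, ∑ k, inner ℂ (E j) (B j k (F k)) := by
  simp [matrixOperator, PiLp.inner_apply, inner_sum]

namespace Medium

variable (M : Medium d)

/-- Uniform ellipticity of the metric: `c` is a lower bound of the matrices `G(x)`. -/
def IsElliptic (c : ℝ) : Prop :=
  ∀ x (v : Fin d → ℝ), c * (v ⬝ᵥ v) ≤ v ⬝ᵥ M.G x *ᵥ v

theorem tendsto_G_sub_one_cocompact (j k : Fin d) :
    Tendsto (fun x => (M.G x - 1) j k) (cocompact _) (𝓝 0) := by
  obtain ⟨c, hc⟩ := M.G_longRange j k 0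
  exact tendsto_zero_of_norm_le_bracket_rpow M.ρ_pos (c := c) fun x => by
    simpa [Matrix.one_apply] using hc x

theorem eventually_half_le_G :
    ∀ᶠ x in cocompact (Space d), ∀ v : Fin d → ℝ, 1 / 2 * (v ⬝ᵥ v) ≤ v ⬝ᵥ M.G x *ᵥ v := by
  have hsmall : ∀ᶠ x in cocompact (Space d), ∀ j k, |(M.G x - 1) j k| ≤ 1 / (2 * (d + 1)) :=
    eventually_all.mpr fun j => eventually_all.mpr fun k =>
      (tendsto_zero_iff_abs_tendsto_zero _).mp (M.tendsto_G_sub_one_cocompact j k)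
        |>.eventually_le_const (by positivity)
  filter_upwards [hsmall] with x hx v
  have hv : 0 ≤ v ⬝ᵥ v := dotProduct_self_star_nonneg v
  have h := (abs_le.mp (abs_dotProduct_mulVec_le hx v)).1
  have hd : 1 / (2 * ((d : ℝ) + 1)) * d ≤ 1 / 2 := by
    rw [one_div_mul_eq_div, div_le_div_iff₀ (by positivity) two_pos]
    linarith
  rw [Matrix.sub_mulVec, Matrix.one_mulVec, dotProduct_sub, Fintype.card_fin] at h
  linarith [mul_le_mul_of_nonneg_right hd hv]

theorem exists_isElliptic : ∃ c > 0, M.IsElliptic c := by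
  obtain ⟨K, hK, hfar⟩ := mem_cocompact.mp M.eventually_half_le_G
  have hcont : Continuous M.G :=
    continuous_matrix fun j k => (M.G_smooth j k).continuous
  obtain ⟨m, hm, hnear⟩ := exists_pos_forall_le_dotProduct_mulVec hK hcont fun x _ => M.G_posDef x
  refine ⟨min m (1 / 2), by positivity, fun x v => ?_⟩
  have hv : 0 ≤ v ⬝ᵥ v := dotProduct_self_star_nonneg v
  by_cases hx : x ∈ K
  · exact (mul_le_mul_of_nonneg_right (min_le_left _ _) hv).trans (hnear x hx v)
  · exact (mul_le_mul_of_nonneg_right (min_le_right _ _) hv).trans (hfar hx v)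

/-- Multiplication of the square integrable vector fields by the matrix `G`. -/
def mulMatrix : VectorL2 d →L[ℂ] VectorL2 d :=
  matrixOperator M.mulG

theorem inner_mulMatrix (E F : VectorL2 d) :
    inner ℂ E (M.mulMatrix F) = ∑ j, ∑ k, inner ℂ (E j) (M.mulG j k (F k)) :=
  inner_matrixOperator M.mulG E F

theorem inner_mulMatrix_self_im (F : VectorL2 d) : (inner ℂ F (M.mulMatrix F)).im = 0 := by
  rw [M.inner_mulMatrix, inner_sum_eq, Complex.ofReal_im]

end Medium

theorem norm_sq_eq_integral (f : L2 d) : ‖f‖ ^ 2 = ∫ x, ‖f x‖ ^ 2 := by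
  have h := inner_self_eq_norm_sq_to_K (𝕜 := ℂ) f
  rw [L2.inner_def] at h
  simp only [inner_self_eq_norm_sq_to_K] at h
  rw [← Complex.ofReal_inj, ← integral_complex_ofReal]
  exact_mod_cast h.symm

variable {M : Medium d}

theorem Medium.IsElliptic.mul_norm_sq_le {c : ℝ} (hc : M.IsElliptic c) (F : VectorL2 d) :
    c * ‖F‖ ^ 2 ≤ (inner ℂ F (M.mulMatrix F)).re := by
  have hint : Integrable fun x => ∑ j, ∑ k, (M.G x j k : ℂ) * (F k x * star (F j x)) :=
    integrable_finsetSum _ fun j _ => integrable_finsetSum _ fun k _ => integrable_mulG M j k _ _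
  have hsq : ∀ j, Integrable fun x => ‖F j x‖ ^ 2 := fun j =>
    (memLp_two_iff_integrable_sq_norm (Lp.aestronglyMeasurable _)).mp (Lp.memLp (F j))
  rw [M.inner_mulMatrix, inner_sum_eq, Complex.ofReal_re, PiLp.norm_sq_eq_of_L2]
  simp only [norm_sq_eq_integral]
  rw [← integral_finsetSum _ fun j _ => hsq j, ← integral_const_mul]
  refine integral_mono ((integrable_finsetSum _ fun j _ => hsq j).const_mul c) ?_ fun x => ?_
  · simpa only [quad_eq, RCLike.re_to_complex, Complex.ofReal_re] using hint.re
  · refine le_of_eq_of_le ?_ (add_le_add (hc x fun j => (F j x).re) (hc x fun j => (F j x).im))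
    simp only [← mul_add, dotProduct, ← Finset.sum_add_distrib, ← Complex.normSq_apply,
      Complex.normSq_eq_norm_sq]

end Ellipticity

/-! ### The energy space -/

section EnergySpace

open Filter Topology

variable {d : ℕ} [Fact (3 ≤ d)] {M : Medium d}

/-- The gradient of an element of `Ḣ¹`. -/
def HDot.grad : HDot M →ₗ[ℂ] VectorL2 d :=
  (WithLp.linearEquiv 2 ℂ (Fin d → L2 d)).symm.toLinearMap ∘ₗ LinearMap.pi HDot.partialDeriv

theorem HDot.l2Emb_grad (u : HDot M) (j : Fin d) :
    ∂_{basisVec j} u.dist = l2Emb d (u.grad j) := (HDot.partialDeriv_spec j u).symm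

theorem HDot.grad_eq {u : HDot M} {g : VectorL2 d}
    (h : ∀ j, ∂_{basisVec j} u.dist = l2Emb d (g j)) : u.grad = g :=
  PiLp.ext fun j => l2Emb_injective d (by rw [← h, HDot.l2Emb_grad])

theorem HDot.inner_eq_inner_grad (u w : HDot M) :
    inner ℂ u w = inner ℂ u.grad (M.mulMatrix w.grad) := by
  rw [M.inner_mulMatrix, HDot.inner_eq]
  rfl

theorem HDot.norm_sq_eq (u : HDot M) :
    ‖u‖ ^ 2 = (inner ℂ u.grad (M.mulMatrix u.grad)).re :=
  (norm_sq_eq_re_inner (𝕜 := ℂ) u).trans (congrArg Complex.re (u.inner_eq_inner_grad u))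

theorem HDot.exists_norm_grad_le (M : Medium d) :
    ∃ C : ℝ, ∀ u : HDot M, ‖u.grad‖ ≤ C * ‖u‖ := by
  obtain ⟨c, hc, hell⟩ := M.exists_isElliptic
  refine ⟨(√c)⁻¹, fun u => ?_⟩
  rw [inv_mul_eq_div, le_div_iff₀ (Real.sqrt_pos.mpr hc)]
  refine le_of_sq_le_sq ?_ (norm_nonneg _)
  rw [mul_pow, Real.sq_sqrt hc.le, HDot.norm_sq_eq, mul_comm]
  exact hell.mul_norm_sq_le _

theorem HDot.norm_le_grad (u : HDot M) : ‖u‖ ≤ √‖M.mulMatrix‖ * ‖u.grad‖ := by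
  refine le_of_sq_le_sq ?_ (by positivity)
  rw [mul_pow, Real.sq_sqrt (norm_nonneg _), HDot.norm_sq_eq]
  calc (inner ℂ u.grad (M.mulMatrix u.grad)).re ≤ ‖u.grad‖ * ‖M.mulMatrix u.grad‖ :=
        (Complex.re_le_norm _).trans (norm_inner_le_norm _ _)
    _ ≤ ‖u.grad‖ * (‖M.mulMatrix‖ * ‖u.grad‖) := by gcongr; exact M.mulMatrix.le_opNorm _
    _ = ‖M.mulMatrix‖ * ‖u.grad‖ ^ 2 := by ring

theorem HDot.isUniformInducing_grad : IsUniformInducing (HDot.grad : HDot M → VectorL2 d) := by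
  obtain ⟨C, hC⟩ := HDot.exists_norm_grad_le M
  exact (AddMonoidHomClass.antilipschitz_of_bound HDot.grad (K := ⟨√‖M.mulMatrix‖, by positivity⟩)
    HDot.norm_le_grad).isUniformInducing
      (AddMonoidHomClass.uniformContinuous_of_bound HDot.grad C hC)

/-- A Schwartz function, as an element of `Ḣ¹`. -/
def schwartzHDot (M : Medium d) (φ : 𝓢(Space d, ℂ)) : HDot M :=
  (⟨(φ : 𝓢'(Space d, ℂ)), schwartz_mem_hdot φ⟩ : hdot d)

theorem schwartzHDot_dist (φ : 𝓢(Space d, ℂ)) :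
    (schwartzHDot M φ).dist = (φ : 𝓢'(Space d, ℂ)) := rfl

theorem schwartzHDot_grad (φ : 𝓢(Space d, ℂ)) : (schwartzHDot M φ).grad = schwartzGrad d φ :=
  HDot.grad_eq fun j => by
    rw [schwartzHDot_dist, lineDerivOp_toTemperedDistributionCLM_eq, schwartzGrad_apply,
      l2Emb_schwartzL2]

theorem HDot.denseRange_schwartzHDot : DenseRange (schwartzHDot M) := fun u => by
  obtain ⟨φ, hφ⟩ := exists_schwartzGrad_tendsto u.l2Emb_grad
  refine mem_closure_of_tendsto (f := schwartzHDot M ∘ φ) (b := atTop) ?_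
    (Eventually.of_forall fun n => Set.mem_range_self _)
  rw [HDot.isUniformInducing_grad.isInducing.tendsto_nhds_iff]
  simpa only [Function.comp_def, schwartzHDot_grad] using hφ

theorem HDot.range_grad : Set.range (HDot.grad : HDot M → VectorL2 d) =
    closure (Set.range (schwartzGrad d)) := by
  refine Set.Subset.antisymm ?_ fun g hg => ?_
  · rintro _ ⟨u, rfl⟩
    obtain ⟨φ, hφ⟩ := exists_schwartzGrad_tendsto u.l2Emb_grad
    exact mem_closure_of_tendsto hφ (Eventually.of_forall fun n => Set.mem_range_self _)
  · obtain ⟨w, hw, hlim⟩ := mem_closure_iff_seq_limit.mp hg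
    choose φ hφ using hw
    obtain ⟨C, hC⟩ := exists_hdot_of_tendsto_schwartzGrad d
    have hgrad : Tendsto (schwartzGrad d ∘ φ) atTop (𝓝 g) := hlim.congr fun n => (hφ n).symm
    obtain ⟨f, hf, -⟩ := hC hgrad
    have hderiv := lineDerivOp_eq_of_tendsto hf hgrad
    exact ⟨(⟨(f : 𝓢'(Space d, ℂ)), ⟨f, rfl⟩, fun j => ⟨g j, hderiv j⟩⟩ : hdot d),
      HDot.grad_eq hderiv⟩

instance : CompleteSpace (HDot M) := by
  rw [completeSpace_iff_isComplete_range HDot.isUniformInducing_grad, HDot.range_grad]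
  exact isClosed_closure.isComplete

theorem HDot.exists_sobolev (M : Medium d) : ∃ C : ℝ, ∀ u : HDot M,
    ∃ f : Lp ℂ (sobolevExp d) (volume : Measure (Space d)),
      u.dist = (f : 𝓢'(Space d, ℂ)) ∧ ‖f‖ ≤ C * ‖u.grad‖ := by
  obtain ⟨C, hC⟩ := exists_hdot_of_tendsto_schwartzGrad d
  refine ⟨C, fun u => ?_⟩
  obtain ⟨φ, hφ⟩ := exists_schwartzGrad_tendsto u.l2Emb_grad
  obtain ⟨f, hf, hle⟩ := hC hφ
  have hderiv := lineDerivOp_eq_of_tendsto hf hφ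
  let w : HDot M := (⟨(f : 𝓢'(Space d, ℂ)), ⟨f, rfl⟩, fun j => ⟨u.grad j, hderiv j⟩⟩ : hdot d)
  have hw : u = w :=
    HDot.isUniformInducing_grad.injective (HDot.grad_eq (u := w) hderiv).symm
  exact ⟨f, congrArg HDot.dist hw, hle⟩

theorem HDot.continuous_dist : Continuous (HDot.dist : HDot M → 𝓢'(Space d, ℂ)) := by
  obtain ⟨C, hC⟩ := HDot.exists_sobolev M
  choose f hf hle using hC
  have hlim : Tendsto f (𝓝 0) (𝓝 0) := squeeze_zero_norm hle <| by
    have hgrad := HDot.isUniformInducing_grad (M := M).uniformContinuous.continuous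
    simpa using (hgrad.norm.const_mul C).tendsto 0
  refine continuous_of_continuousAt_zero HDot.dist ?_
  rw [ContinuousAt, map_zero, funext hf]
  have hcont := (Lp.toTemperedDistributionCLM ℂ (volume : Measure (Space d))
    (sobolevExp d)).continuous.tendsto 0
  rw [map_zero] at hcont
  exact hcont.comp hlim

theorem denseRange_schwartzPair (M : Medium d) :
    DenseRange fun p : 𝓢(Space d, ℂ) × 𝓢(Space d, ℂ) => schwartzPair M p.1 p.2 :=
  (WithLp.toLp_surjective 2).denseRange.comp
    (HDot.denseRange_schwartzHDot.prodMap denseRange_schwartzL2)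
    (WithLp.prod_continuous_toLp 2 (HDot M) (L2 d))

end EnergySpace

/-! ### Coefficients acting on distributions -/

section Coefficients

variable {d : ℕ}

theorem hasTemperateGrowth_fderiv_apply {g : Space d → ℂ} (hg : g.HasTemperateGrowth)
    (m : Space d) : (fun x => fderiv ℝ g x m).HasTemperateGrowth := by
  have hderiv : (fderiv ℝ g).HasTemperateGrowth :=
    ⟨hg.1.fderiv_right (by simp), fun n => by
      simpa only [norm_iteratedFDeriv_fderiv] using hg.2 (n + 1)⟩
  exact (ContinuousLinearMap.apply ℝ ℂ m).hasTemperateGrowth.comp hderiv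

theorem schwartz_lineDerivOp_smulLeftCLM {g : Space d → ℂ} (hg : g.HasTemperateGrowth)
    (m : Space d) (φ : 𝓢(Space d, ℂ)) : ∂_{m} (SchwartzMap.smulLeftCLM ℂ g φ) =
      SchwartzMap.smulLeftCLM ℂ (fun x => fderiv ℝ g x m) φ +
        SchwartzMap.smulLeftCLM ℂ g (∂_{m} φ) := by
  ext x
  have hprod := ((hg.1.differentiable (by simp) x).hasFDerivAt.mul (φ.hasFDerivAt x)).fderiv
  rw [SchwartzMap.lineDerivOp_apply_eq_fderiv, SchwartzMap.smulLeftCLM_apply hg, add_apply,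
    SchwartzMap.smulLeftCLM_apply_apply (hasTemperateGrowth_fderiv_apply hg m),
    SchwartzMap.smulLeftCLM_apply_apply hg, SchwartzMap.lineDerivOp_apply_eq_fderiv]
  refine (congrArg (fun L : Space d →L[ℝ] ℂ => L m) hprod).trans ?_
  simp only [add_apply, smul_apply, smul_eq_mul]
  ring

theorem lineDerivOp_smulLeftCLM {g : Space d → ℂ} (hg : g.HasTemperateGrowth) (m : Space d)
    (T : 𝓢'(Space d, ℂ)) : ∂_{m} (TemperedDistribution.smulLeftCLM ℂ g T) =
      TemperedDistribution.smulLeftCLM ℂ (fun x => fderiv ℝ g x m) T +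
        TemperedDistribution.smulLeftCLM ℂ g (∂_{m} T) := by
  ext ψ
  simp only [add_apply, TemperedDistribution.lineDerivOp_apply_apply,
    TemperedDistribution.smulLeftCLM_apply_apply, schwartz_lineDerivOp_smulLeftCLM hg, map_neg,
    map_add]
  abel

theorem l2Emb_mulL2 {g : Space d → ℂ} (hg : MemLp g ∞ (volume : Measure (Space d)))
    (hg' : g.HasTemperateGrowth) (f : L2 d) :
    l2Emb d (mulL2 g hg f) = TemperedDistribution.smulLeftCLM ℂ g (l2Emb d f) := by
  ext ψ
  rw [TemperedDistribution.smulLeftCLM_apply_apply, l2Emb_apply, l2Emb_apply]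
  refine integral_congr_ae ?_
  filter_upwards [mulL2_coeFn g hg f] with x hx
  rw [hx, SchwartzMap.smulLeftCLM_apply_apply hg', smul_eq_mul]
  ring

namespace Medium

variable (M : Medium d)

theorem exists_norm_iteratedFDeriv_G_le (j k : Fin d) (n : ℕ) : ∃ C : ℝ, ∀ x,
    ‖iteratedFDeriv ℝ n (fun y => M.G y j k - if j = k then 1 else 0) x‖ ≤ C := by
  obtain ⟨c, hc⟩ := M.G_longRange j k n
  have hs : -M.ρ - n ≤ 0 := by linarith [M.ρ_pos, Nat.cast_nonneg (α := ℝ) n]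
  refine ⟨|c|, fun x => ?_⟩
  simpa only [norm_norm] using bounded_of_decay
    (f := fun x => ‖iteratedFDeriv ℝ n (fun y => M.G y j k - if j = k then 1 else 0) x‖) hs
    (by simpa only [norm_norm] using hc) x

theorem hasTemperateGrowth_G (j k : Fin d) :
    (fun x => (M.G x j k : ℂ)).HasTemperateGrowth := by
  have hsub : (fun x => M.G x j k - if j = k then 1 else 0).HasTemperateGrowth := by
    refine ⟨(M.G_smooth j k).sub contDiff_const, fun n => ?_⟩
    obtain ⟨C, hC⟩ := M.exists_norm_iteratedFDeriv_G_le j k n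
    exact ⟨0, C, fun x => by simpa using hC x⟩
  have hG := hsub.add (Function.HasTemperateGrowth.const (if j = k then (1 : ℝ) else 0))
  simp only [Pi.add_def, sub_add_cancel] at hG
  fun_prop

/-- The derivative `∂_l G_{jk}`, as a complex valued function. -/
def dG (l j k : Fin d) (x : Space d) : ℂ :=
  fderiv ℝ (fun x => (M.G x j k : ℂ)) x (basisVec l)

theorem hasTemperateGrowth_dG (l j k : Fin d) : (M.dG l j k).HasTemperateGrowth :=
  hasTemperateGrowth_fderiv_apply (M.hasTemperateGrowth_G j k) (basisVec l)

theorem memLp_dG (l j k : Fin d) : MemLp (M.dG l j k) ∞ (volume : Measure (Space d)) := by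
  obtain ⟨C, hC⟩ := M.exists_norm_iteratedFDeriv_G_le j k 1
  refine memLp_top_of_bound (C := C)
    (M.hasTemperateGrowth_dG l j k).1.continuous.aestronglyMeasurable (.of_forall fun x => ?_)
  have hbound : ‖fderiv ℝ (fun y => M.G y j k) x‖ ≤ C := by
    simpa only [norm_iteratedFDeriv_one, fderiv_sub_const] using hC x
  have hderiv := Complex.ofRealCLM.hasFDerivAt.comp x
    ((M.G_smooth j k).differentiable (by simp) x).hasFDerivAt
  have hval : M.dG l j k x = (fderiv ℝ (fun y => M.G y j k) x (basisVec l) : ℂ) :=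
    congrArg (fun L : Space d →L[ℝ] ℂ => L (basisVec l)) hderiv.fderiv
  rw [hval, Complex.norm_real]
  exact ((fderiv ℝ (fun y => M.G y j k) x).unit_le_opNorm _ (by simp)).trans hbound

/-- Multiplication by `∂_l G_{jk}`, on `L²`. -/
def mulDG (l j k : Fin d) : L2 d →L[ℂ] L2 d := mulL2 (M.dG l j k) (M.memLp_dG l j k)

theorem l2Emb_mulG (j k : Fin d) (f : L2 d) : l2Emb d (M.mulG j k f) =
    TemperedDistribution.smulLeftCLM ℂ (fun x => (M.G x j k : ℂ)) (l2Emb d f) :=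
  l2Emb_mulL2 _ (M.hasTemperateGrowth_G j k) f

theorem H0_eq (T : 𝓢'(Space d, ℂ)) : M.H0 T = -∑ j, ∑ k, ∂_{basisVec j}
    (TemperedDistribution.smulLeftCLM ℂ (fun x => (M.G x j k : ℂ)) (∂_{basisVec k} T)) := by
  simp [H0]

theorem inner_schwartzGrad_mulMatrix (φ : 𝓢(Space d, ℂ)) {g : VectorL2 d} {T : 𝓢'(Space d, ℂ)}
    (hT : ∀ j, ∂_{basisVec j} T = l2Emb d (g j)) :
    inner ℂ (schwartzGrad d φ) (M.mulMatrix g) = M.H0 T (schwartzConj φ) := by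
  rw [M.inner_mulMatrix, M.H0_eq, neg_apply]
  simp only [sum_apply, schwartzGrad_apply, inner_schwartzL2_lineDerivOp, l2Emb_mulG, hT,
    Finset.sum_neg_distrib]

end Medium

end Coefficients

section Green

open Filter Topology

variable {d : ℕ} [hd : Fact (3 ≤ d)] {M : Medium d}

theorem HDot.inner_eq_inner_H0 {u v : HDot M} {v' w : L2 d} (hv : v.dist = l2Emb d v')
    (hw : M.H0 u.dist = l2Emb d w) : inner ℂ v u = inner ℂ v' w := by
  have : NeZero d := ⟨by have := hd.out; omega⟩
  obtain ⟨φ, hφ, hgrad⟩ := exists_schwartzL2_schwartzGrad_tendsto (v := v') (g := v.grad)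
    fun j => by rw [← hv, HDot.l2Emb_grad]
  have hschwartz : ∀ n, inner ℂ (schwartzGrad d (φ n)) (M.mulMatrix u.grad) =
      inner ℂ (schwartzL2 d (φ n)) w := fun n => by
    rw [M.inner_schwartzGrad_mulMatrix _ u.l2Emb_grad, hw, inner_schwartzL2]
  rw [HDot.inner_eq_inner_grad]
  exact tendsto_nhds_unique (hgrad.inner tendsto_const_nhds)
    ((hφ.inner tendsto_const_nhds).congr fun n => (hschwartz n).symm)

end Green

/-! ### Operators of order two on `L²` -/

section Operators

open Filter Topology
open scoped Laplacian Real ComplexOrder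

variable {d : ℕ}

/-- The restriction to `L²` of a continuous operator on the tempered distributions which
preserves `L²`; it is bounded by the closed graph theorem. -/
def l2Restrict (Φ : 𝓢'(Space d, ℂ) →L[ℂ] 𝓢'(Space d, ℂ))
    (h : ∀ f, Φ (l2Emb d f) ∈ LinearMap.range (l2Emb d)) : L2 d →L[ℂ] L2 d where
  toLinearMap := l2Rep d ∘ₗ (Φ.toLinearMap ∘ₗ l2Emb d).codRestrict (LinearMap.range (l2Emb d)) h
  cont := by
    refine LinearMap.continuous_of_seq_closed_graph _ fun u f g hu hg => l2Emb_injective d ?_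
    have hval : ∀ f, l2Emb d (l2Rep d ⟨Φ (l2Emb d f), h f⟩) = Φ (l2Emb d f) := fun f =>
      l2Emb_l2Rep _
    have hcont := ((Φ.continuous.comp continuous_l2Emb).tendsto f).comp hu
    exact (tendsto_nhds_unique ((continuous_l2Emb.tendsto g).comp hg)
      (hcont.congr fun n => (hval (u n)).symm)).trans (hval f).symm

theorem l2Emb_l2Restrict {Φ : 𝓢'(Space d, ℂ) →L[ℂ] 𝓢'(Space d, ℂ)}
    (h : ∀ f, Φ (l2Emb d f) ∈ LinearMap.range (l2Emb d)) (f : L2 d) :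
    l2Emb d (l2Restrict Φ h f) = Φ (l2Emb d f) :=
  l2Emb_l2Rep ⟨Φ (l2Emb d f), h f⟩

theorem mem_range_l2Emb_of_memSobolev {s : ℝ} (hs : 0 ≤ s) {T : 𝓢'(Space d, ℂ)}
    (h : MemSobolev s 2 T) : T ∈ LinearMap.range (l2Emb d) := by
  obtain ⟨f, hf⟩ := memSobolev_zero_iff.mp (h.mono hs)
  exact ⟨f, hf.symm⟩

theorem memSobolev_besselPotential (f : L2 d) :
    MemSobolev 2 2 (besselPotential (Space d) ℂ (-2) (l2Emb d f)) := by
  rw [memSobolev_besselPotential_iff, neg_add_cancel]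
  exact memSobolev_zero_iff.mpr ⟨f, rfl⟩

theorem besselPotential_two_eq (T : 𝓢'(Space d, ℂ)) :
    besselPotential (Space d) ℂ 2 T = T - ((((2 * π) ^ 2)⁻¹ : ℝ) : ℂ) • Δ T := by
  simpa [besselPotential] using fourierMultiplierCLM_add_mul_norm_sq 1 1 T

/-- The operator `(1 - (2π)⁻² Δ)⁻¹` on `L²`, an isomorphism from `L²` to `H²`. -/
def besselL2 (d : ℕ) : L2 d →L[ℂ] L2 d :=
  l2Restrict (besselPotential (Space d) ℂ (-2)) fun f =>
    mem_range_l2Emb_of_memSobolev zero_le_two (memSobolev_besselPotential f)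

theorem l2Emb_besselL2 (f : L2 d) :
    l2Emb d (besselL2 d f) = besselPotential (Space d) ℂ (-2) (l2Emb d f) :=
  l2Emb_l2Restrict _ f

theorem memSobolev_besselL2 (f : L2 d) : MemSobolev 2 2 (l2Emb d (besselL2 d f)) := by
  rw [l2Emb_besselL2]
  exact memSobolev_besselPotential f

theorem exists_besselL2_eq_of_memSobolev {u : L2 d} (hu : MemSobolev 2 2 (l2Emb d u)) :
    ∃ f, besselL2 d f = u := by
  obtain ⟨f, hf⟩ := hu
  exact ⟨f, l2Emb_injective d <| by
    rw [l2Emb_besselL2, besselPotential_neg_apply_eq_iff]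
    exact hf⟩

theorem exists_schwartz_besselL2 (f : 𝓢(Space d, ℂ)) : ∃ u : 𝓢(Space d, ℂ),
    besselL2 d (schwartzL2 d f) = schwartzL2 d u ∧
      schwartzL2 d f = schwartzL2 d u - ((((2 * π) ^ 2)⁻¹ : ℝ) : ℂ) • schwartzL2 d (Δ u) := by
  let u : 𝓢(Space d, ℂ) := SchwartzMap.fourierMultiplierCLM ℂ
    (fun x : Space d => (((1 + ‖x‖ ^ 2) ^ ((-2 : ℝ) / 2) : ℝ) : ℂ)) f
  have hu : besselPotential (Space d) ℂ (-2) (f : 𝓢'(Space d, ℂ)) = (u : 𝓢'(Space d, ℂ)) :=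
    fourierMultiplierCLM_toTemperedDistributionCLM_eq (by fun_prop) f
  refine ⟨u, l2Emb_injective d ?_, l2Emb_injective d ?_⟩
  · rw [l2Emb_besselL2, l2Emb_schwartzL2, l2Emb_schwartzL2, hu]
  · rw [besselPotential_neg_apply_eq_iff, besselPotential_two_eq,
      laplacian_toTemperedDistributionCLM_eq] at hu
    rw [map_sub, map_smul, l2Emb_schwartzL2, l2Emb_schwartzL2, l2Emb_schwartzL2]
    exact hu.symm

theorem inner_schwartzL2_schwartzL2_laplacian (φ u : 𝓢(Space d, ℂ)) :
    inner ℂ (schwartzL2 d φ) (schwartzL2 d (Δ u)) =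
      -inner ℂ (schwartzGrad d φ) (schwartzGrad d u) := by
  rw [inner_schwartzL2, l2Emb_schwartzL2, inner_schwartzGrad φ (T := (u : 𝓢'(Space d, ℂ)))
    fun j => ?_, laplacian_toTemperedDistributionCLM_eq, neg_neg]
  rw [lineDerivOp_toTemperedDistributionCLM_eq, schwartzGrad_apply, l2Emb_schwartzL2]

theorem re_inner_besselL2_nonneg (f : L2 d) : 0 ≤ (inner ℂ f (besselL2 d f)).re := by
  refine denseRange_schwartzL2.induction_on
    (p := fun f => 0 ≤ (inner ℂ f (besselL2 d f)).re) f
    (isClosed_le continuous_const (Complex.continuous_re.comp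
      (continuous_id.inner (besselL2 d).continuous))) fun φ => ?_
  obtain ⟨u, hu, hφ⟩ := exists_schwartz_besselL2 φ
  rw [hu, hφ, ← inner_conj_symm, Complex.conj_re, inner_sub_right, inner_smul_right,
    inner_schwartzL2_schwartzL2_laplacian, mul_neg, sub_neg_eq_add, Complex.add_re,
    Complex.re_ofReal_mul]
  exact add_nonneg (inner_self_nonneg (𝕜 := ℂ))
    (mul_nonneg (by positivity) (inner_self_nonneg (𝕜 := ℂ)))

namespace Medium

variable (M : Medium d)

theorem H0_mem_range_l2Emb {T : 𝓢'(Space d, ℂ)} (h : MemSobolev 2 2 T) :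
    M.H0 T ∈ LinearMap.range (l2Emb d) := by
  rw [M.H0_eq]
  refine neg_mem (sum_mem fun j _ => sum_mem fun k _ => ?_)
  obtain ⟨f, hf⟩ := mem_range_l2Emb_of_memSobolev (by norm_num) (h.lineDerivOp (m := basisVec k))
  obtain ⟨g, hg⟩ := mem_range_l2Emb_of_memSobolev (by norm_num)
    ((h.lineDerivOp (m := basisVec k)).lineDerivOp (m := basisVec j))
  rw [lineDerivOp_smulLeftCLM (M.hasTemperateGrowth_G j k), ← hg, ← l2Emb_mulG, ← hf]
  exact add_mem ⟨M.mulDG j j k f, l2Emb_mulL2 _ (M.hasTemperateGrowth_dG j j k) f⟩ ⟨_, rfl⟩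

/-- The operator `H₀ (1 - (2π)⁻² Δ)⁻¹` on `L²`. -/
def H0Bessel : L2 d →L[ℂ] L2 d :=
  l2Restrict (M.H0 ∘L besselPotential (Space d) ℂ (-2)) fun f =>
    M.H0_mem_range_l2Emb (memSobolev_besselPotential f)

theorem l2Emb_H0Bessel (f : L2 d) : l2Emb d (M.H0Bessel f) = M.H0 (l2Emb d (besselL2 d f)) := by
  rw [l2Emb_besselL2]
  exact l2Emb_l2Restrict _ f

/-- The operator `i z a + z²` on `L²`: the terms of order zero of `H₀ - i z a - z²`. -/
def lowerOrder (z : ℂ) : L2 d →L[ℂ] L2 d :=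
  (Complex.I * z) • M.mulA + z ^ 2 • ContinuousLinearMap.id ℂ (L2 d)

/-- The operator `(H₀ - i z a - z²) (1 - (2π)⁻² Δ)⁻¹` on `L²`. -/
def stationary (z : ℂ) : L2 d →L[ℂ] L2 d := M.H0Bessel - M.lowerOrder z ∘L besselL2 d

theorem stationary_apply (z : ℂ) (f : L2 d) :
    M.stationary z f = M.H0Bessel f - M.lowerOrder z (besselL2 d f) := rfl

theorem isInverse_iff {z : ℂ} {R : L2 d →L[ℂ] L2 d} : M.IsInverse z R ↔
    ∀ f u, R f = u ↔ MemSobolev 2 2 (l2Emb d u) ∧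
      M.H0 (l2Emb d u) = l2Emb d (M.lowerOrder z u + f) := by
  simp only [map_add, ← sub_eq_iff_eq_add']
  rfl

theorem inner_mulA_nonneg (u : L2 d) : 0 ≤ inner ℂ u (M.mulA u) := by
  have hval : inner ℂ u (M.mulA u) = ((∫ x, M.a x * ‖u x‖ ^ 2 : ℝ) : ℂ) := by
    rw [L2.inner_def, ← integral_complex_ofReal]
    refine integral_congr_ae ?_
    filter_upwards [mulL2_coeFn _ M.memLp_a u] with x hx
    rw [mulA, hx, RCLike.inner_apply, mul_assoc, Complex.mul_conj']
    push_cast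
    rfl
  rw [hval]
  exact Complex.zero_le_real.mpr (integral_nonneg fun x => mul_nonneg (M.a_nonneg x) (sq_nonneg _))

theorem lineDerivOp_H0 (l : Fin d) (T : 𝓢'(Space d, ℂ)) :
    ∂_{basisVec l} (M.H0 T) = M.H0 (∂_{basisVec l} T) -
      ∑ j, ∑ k, ∂_{basisVec j} (TemperedDistribution.smulLeftCLM ℂ (M.dG l j k)
        (∂_{basisVec k} T)) := by
  rw [M.H0_eq, M.H0_eq, lineDerivOp_neg, lineDerivOp_sum, neg_sub_left, neg_inj,
    ← Finset.sum_add_distrib]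
  refine Finset.sum_congr rfl fun j _ => ?_
  rw [lineDerivOp_sum, ← Finset.sum_add_distrib]
  refine Finset.sum_congr rfl fun k _ => ?_
  rw [lineDerivOp_comm, lineDerivOp_smulLeftCLM (M.hasTemperateGrowth_G j k), lineDerivOp_add,
    lineDerivOp_comm (basisVec l) (basisVec k)]
  rfl

end Medium

end Operators

/-! ### Coercivity and the resolvent `R(z)` -/

section Coercivity

open Filter Topology
open scoped Laplacian Real ComplexOrder

variable {d : ℕ}

theorem exists_coercive_combination {m p : ℝ} (hm : 0 < m) (hp : 0 < p) (C e : ℝ) :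
    ∃ ν ≥ 0, ∃ c > 0, ∀ {a b F P Q : ℝ}, 0 ≤ F → F ≤ a + e * b → m * a ^ 2 ≤ P →
      p * b ^ 2 - C * a * b ≤ Q → c * F ^ 2 ≤ (1 + ν) * P + Q := by
  have hν : 0 ≤ C ^ 2 / (2 * p * m) := by positivity
  refine ⟨C ^ 2 / (2 * p * m), hν, min (m / 2) (p / (4 * (e ^ 2 + 1))), by positivity,
    fun {a b F P Q} hF0 hF hP hQ => ?_⟩
  have hcm : min (m / 2) (p / (4 * (e ^ 2 + 1))) ≤ m / 2 := min_le_left _ _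
  have hcp : min (m / 2) (p / (4 * (e ^ 2 + 1))) * (e ^ 2 + 1) ≤ p / 4 := by
    rw [← le_div_iff₀ (by positivity), div_div]
    exact min_le_right _ _
  have hc0 : 0 < min (m / 2) (p / (4 * (e ^ 2 + 1))) := by positivity
  generalize min (m / 2) (p / (4 * (e ^ 2 + 1))) = c at hcm hcp hc0 ⊢
  have hνP : C ^ 2 / (2 * p) * a ^ 2 ≤ C ^ 2 / (2 * p * m) * P :=
    (mul_le_mul_of_nonneg_left hP hν).trans_eq' (by field_simp)
  have hyoung : C * a * b ≤ C ^ 2 / (2 * p) * a ^ 2 + p / 2 * b ^ 2 := by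
    have h : C ^ 2 / (2 * p) * a ^ 2 + p / 2 * b ^ 2 - C * a * b =
        (C * a - p * b) ^ 2 / (2 * p) := by field_simp; ring
    have : 0 ≤ (C * a - p * b) ^ 2 / (2 * p) := by positivity
    linarith
  calc c * F ^ 2 ≤ c * (2 * a ^ 2 + 2 * (e ^ 2 + 1) * b ^ 2) := by
        gcongr
        nlinarith [pow_le_pow_left₀ hF0 hF 2, sq_nonneg (a - e * b), sq_nonneg b]
    _ ≤ m * a ^ 2 + p / 2 * b ^ 2 := by
        nlinarith [mul_le_mul_of_nonneg_right hcm (sq_nonneg a),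
          mul_le_mul_of_nonneg_right hcp (sq_nonneg b)]
    _ ≤ (1 + C ^ 2 / (2 * p * m)) * P + Q := by linarith

/-- The Hessian of a Schwartz function, in `L²`. -/
def schwartzHess (φ : 𝓢(Space d, ℂ)) : PiLp 2 fun _ : Fin d => VectorL2 d :=
  WithLp.toLp 2 fun l => schwartzGrad d (∂_{basisVec l} φ)

theorem schwartzHess_apply (φ : 𝓢(Space d, ℂ)) (l : Fin d) :
    schwartzHess φ l = schwartzGrad d (∂_{basisVec l} φ) := rfl

theorem schwartz_laplacian_eq_sum_basisVec (φ : 𝓢(Space d, ℂ)) :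
    Δ φ = ∑ j : Fin d, ∂_{basisVec j} (∂_{basisVec j} φ) := by
  simpa only [EuclideanSpace.basisFun_apply] using
    SchwartzMap.laplacian_eq_sum (EuclideanSpace.basisFun (Fin d) ℝ) φ

theorem norm_schwartzL2_laplacian_le (φ : 𝓢(Space d, ℂ)) :
    ‖schwartzL2 d (Δ φ)‖ ≤ d * ‖schwartzHess φ‖ := by
  have hterm : ∀ l : Fin d, ‖schwartzL2 d (∂_{basisVec l} (∂_{basisVec l} φ))‖ ≤ ‖schwartzHess φ‖ :=
    fun l => (PiLp.norm_apply_le (schwartzHess φ l) l).trans (PiLp.norm_apply_le _ l)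
  rw [schwartz_laplacian_eq_sum_basisVec, map_sum]
  simpa using norm_sum_le_of_le Finset.univ fun l _ => hterm l

theorem norm_sq_schwartzJet (φ : 𝓢(Space d, ℂ)) :
    ‖schwartzJet d φ‖ ^ 2 = ‖schwartzL2 d φ‖ ^ 2 + ‖schwartzGrad d φ‖ ^ 2 :=
  WithLp.prod_norm_sq_eq_of_L2 _

theorem norm_schwartzL2_le_schwartzJet (φ : 𝓢(Space d, ℂ)) :
    ‖schwartzL2 d φ‖ ≤ ‖schwartzJet d φ‖ :=
  WithLp.norm_fst_le (L2 d) (schwartzJet d φ)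

theorem norm_schwartzGrad_le_schwartzJet (φ : 𝓢(Space d, ℂ)) :
    ‖schwartzGrad d φ‖ ≤ ‖schwartzJet d φ‖ :=
  WithLp.norm_snd_le (L2 d) (schwartzJet d φ)

theorem norm_schwartzL2_sub_smul_laplacian_le (u : 𝓢(Space d, ℂ)) {κ : ℝ} (hκ : 0 ≤ κ) :
    ‖schwartzL2 d u - (κ : ℂ) • schwartzL2 d (Δ u)‖ ≤
      ‖schwartzJet d u‖ + κ * d * ‖schwartzHess u‖ := by
  rw [mul_assoc]
  refine norm_sub_le_of_le (norm_schwartzL2_le_schwartzJet u) ?_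
  rw [norm_smul, Complex.norm_of_nonneg hκ]
  exact mul_le_mul_of_nonneg_left (norm_schwartzL2_laplacian_le u) hκ

theorem inner_schwartzL2_laplacian (φ : 𝓢(Space d, ℂ)) (h : L2 d) :
    inner ℂ (schwartzL2 d (Δ φ)) h =
      -∑ l : Fin d, (∂_{basisVec l} (l2Emb d h)) (schwartzConj (∂_{basisVec l} φ)) := by
  rw [schwartz_laplacian_eq_sum_basisVec, map_sum, sum_inner]
  simp only [inner_schwartzL2_lineDerivOp, Finset.sum_neg_distrib]

namespace Medium

variable (M : Medium d)

/-- Multiplication of the square integrable vector fields by the matrix `∂_l G`. -/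
def mulDMatrix (l : Fin d) : VectorL2 d →L[ℂ] VectorL2 d := matrixOperator (M.mulDG l)

theorem inner_schwartzGrad_mulDMatrix (φ u : 𝓢(Space d, ℂ)) (l : Fin d) :
    inner ℂ (schwartzGrad d φ) (M.mulDMatrix l (schwartzGrad d u)) =
      -(∑ j, ∑ k, ∂_{basisVec j} (TemperedDistribution.smulLeftCLM ℂ (M.dG l j k)
        (∂_{basisVec k} (u : 𝓢'(Space d, ℂ))))) (schwartzConj φ) := by
  rw [mulDMatrix, inner_matrixOperator]
  simp only [sum_apply, schwartzGrad_apply, inner_schwartzL2_lineDerivOp, mulDG,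
    l2Emb_mulL2 _ (M.hasTemperateGrowth_dG _ _ _), l2Emb_schwartzL2,
    lineDerivOp_toTemperedDistributionCLM_eq, Finset.sum_neg_distrib]

theorem inner_schwartzGrad_mulMatrix_schwartzGrad (φ u : 𝓢(Space d, ℂ)) :
    inner ℂ (schwartzGrad d φ) (M.mulMatrix (schwartzGrad d u)) =
      M.H0 (u : 𝓢'(Space d, ℂ)) (schwartzConj φ) :=
  M.inner_schwartzGrad_mulMatrix φ fun j => by
    rw [lineDerivOp_toTemperedDistributionCLM_eq, schwartzGrad_apply, l2Emb_schwartzL2]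

variable {M} {u : 𝓢(Space d, ℂ)} {h : L2 d}

theorem inner_schwartzL2_of_H0_eq (hh : M.H0 (u : 𝓢'(Space d, ℂ)) = l2Emb d h) :
    inner ℂ (schwartzL2 d u) h = inner ℂ (schwartzGrad d u) (M.mulMatrix (schwartzGrad d u)) := by
  rw [inner_schwartzL2, ← hh, inner_schwartzGrad_mulMatrix_schwartzGrad]

theorem inner_schwartzL2_laplacian_of_H0_eq (hh : M.H0 (u : 𝓢'(Space d, ℂ)) = l2Emb d h) :
    -inner ℂ (schwartzL2 d (Δ u)) h =
      ∑ l, inner ℂ (schwartzHess u l) (M.mulMatrix (schwartzHess u l)) +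
        ∑ l, inner ℂ (schwartzHess u l) (M.mulDMatrix l (schwartzGrad d u)) := by
  rw [inner_schwartzL2_laplacian, neg_neg, ← Finset.sum_add_distrib, ← hh]
  refine Finset.sum_congr rfl fun l _ => ?_
  rw [M.lineDerivOp_H0, sub_apply, schwartzHess_apply, inner_schwartzGrad_mulDMatrix,
    inner_schwartzGrad_mulMatrix_schwartzGrad, lineDerivOp_toTemperedDistributionCLM_eq,
    ← sub_eq_add_neg]

theorem first_order_estimate {z : ℂ} (hz : 0 < z.im) {c : ℝ} (hc : M.IsElliptic c)
    (hh : M.H0 (u : 𝓢'(Space d, ℂ)) = l2Emb d h) :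
    z.im * min c (‖z‖ ^ 2) * ‖schwartzJet d u‖ ^ 2 ≤
      (Complex.I * star z *
        inner ℂ (schwartzL2 d u) (h - M.lowerOrder z (schwartzL2 d u))).re := by
  have hG := hc.mul_norm_sq_le (schwartzGrad d u)
  have hG' := M.inner_mulMatrix_self_im (schwartzGrad d u)
  obtain ⟨ha, ha'⟩ := Complex.nonneg_iff.mp (M.inner_mulA_nonneg (schwartzL2 d u))
  have hlower : inner ℂ (schwartzL2 d u) (M.lowerOrder z (schwartzL2 d u)) =
      Complex.I * z * inner ℂ (schwartzL2 d u) (M.mulA (schwartzL2 d u)) +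
        z ^ 2 * (‖schwartzL2 d u‖ ^ 2 : ℝ) := by
    have hself : ((‖schwartzL2 d u‖ ^ 2 : ℝ) : ℂ) = inner ℂ (schwartzL2 d u) (schwartzL2 d u) := by
      rw [inner_self_eq_norm_sq_to_K, Complex.ofReal_pow]
      rfl
    rw [hself, ← inner_smul_right, ← inner_smul_right, ← inner_add_right]
    rfl
  rw [inner_sub_right, inner_schwartzL2_of_H0_eq hh, hlower, norm_sq_schwartzJet]
  generalize inner ℂ (schwartzGrad d u) (M.mulMatrix (schwartzGrad d u)) = A at hG hG' ⊢
  generalize inner ℂ (schwartzL2 d u) (M.mulA (schwartzL2 d u)) = b at ha ha' ⊢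
  have hre : (Complex.I * star z * (A - (Complex.I * z * b + z ^ 2 *
      (‖schwartzL2 d u‖ ^ 2 : ℝ)))).re =
        z.im * A.re + ‖z‖ ^ 2 * b.re + z.im * ‖z‖ ^ 2 * ‖schwartzL2 d u‖ ^ 2 := by
    rw [Complex.sq_norm, Complex.normSq_apply]
    simp [sq, hG', ← ha']
    ring
  rw [hre]
  have hmin₁ := mul_le_mul_of_nonneg_right (min_le_left c (‖z‖ ^ 2))
    (sq_nonneg ‖schwartzGrad d u‖)
  have hmin₂ := mul_le_mul_of_nonneg_right (min_le_right c (‖z‖ ^ 2))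
    (sq_nonneg ‖schwartzL2 d u‖)
  nlinarith [mul_le_mul_of_nonneg_left (hmin₁.trans hG) hz.le,
    mul_le_mul_of_nonneg_left hmin₂ hz.le, mul_nonneg (sq_nonneg ‖z‖) ha]

variable (M) in
theorem norm_commutator_add_lowerOrder_le (z : ℂ) (u : 𝓢(Space d, ℂ)) :
    ‖∑ l, inner ℂ (schwartzHess u l) (M.mulDMatrix l (schwartzGrad d u)) +
        inner ℂ (schwartzL2 d (Δ u)) (M.lowerOrder z (schwartzL2 d u))‖ ≤
      (∑ l, ‖M.mulDMatrix l‖ + d * ‖M.lowerOrder z‖) * ‖schwartzJet d u‖ * ‖schwartzHess u‖ := by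
  have hcomm : ∀ l, ‖inner ℂ (schwartzHess u l) (M.mulDMatrix l (schwartzGrad d u))‖ ≤
      ‖schwartzHess u‖ * (‖M.mulDMatrix l‖ * ‖schwartzJet d u‖) := fun l =>
    (norm_inner_le_norm _ _).trans <| mul_le_mul (PiLp.norm_apply_le _ l)
      ((M.mulDMatrix l).le_opNorm_of_le (norm_schwartzGrad_le_schwartzJet u))
      (norm_nonneg _) (norm_nonneg _)
  have hlower : ‖inner ℂ (schwartzL2 d (Δ u)) (M.lowerOrder z (schwartzL2 d u))‖ ≤
      d * ‖schwartzHess u‖ * (‖M.lowerOrder z‖ * ‖schwartzJet d u‖) :=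
    (norm_inner_le_norm _ _).trans <| mul_le_mul (norm_schwartzL2_laplacian_le u)
      ((M.lowerOrder z).le_opNorm_of_le (norm_schwartzL2_le_schwartzJet u))
      (norm_nonneg _) (by positivity)
  refine (norm_add_le_of_le (norm_sum_le_of_le Finset.univ fun l _ => hcomm l) hlower).trans_eq ?_
  rw [← Finset.mul_sum, ← Finset.sum_mul]
  ring

theorem second_order_estimate {z : ℂ} (hz : 0 < z.im) {c : ℝ} (hc : M.IsElliptic c)
    (hh : M.H0 (u : 𝓢'(Space d, ℂ)) = l2Emb d h) :
    z.im * c * ‖schwartzHess u‖ ^ 2 - ‖z‖ * (∑ l, ‖M.mulDMatrix l‖ + d * ‖M.lowerOrder z‖) *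
        ‖schwartzJet d u‖ * ‖schwartzHess u‖ ≤
      (Complex.I * star z *
        -inner ℂ (schwartzL2 d (Δ u)) (h - M.lowerOrder z (schwartzL2 d u))).re := by
  have hprincipal : c * ‖schwartzHess u‖ ^ 2 ≤
      (∑ l, inner ℂ (schwartzHess u l) (M.mulMatrix (schwartzHess u l))).re := by
    rw [PiLp.norm_sq_eq_of_L2, Finset.mul_sum, Complex.re_sum]
    exact Finset.sum_le_sum fun l _ => hc.mul_norm_sq_le _
  have hreal : (∑ l, inner ℂ (schwartzHess u l) (M.mulMatrix (schwartzHess u l))).im = 0 := by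
    rw [Complex.im_sum]
    exact Finset.sum_eq_zero fun l _ => M.inner_mulMatrix_self_im _
  have herror := M.norm_commutator_add_lowerOrder_le z u
  rw [inner_sub_right, neg_sub', sub_neg_eq_add, inner_schwartzL2_laplacian_of_H0_eq hh, add_assoc]
  generalize ∑ l, inner ℂ (schwartzHess u l) (M.mulMatrix (schwartzHess u l)) = A
    at hprincipal hreal ⊢
  generalize ∑ l, inner ℂ (schwartzHess u l) (M.mulDMatrix l (schwartzGrad d u)) +
    inner ℂ (schwartzL2 d (Δ u)) (M.lowerOrder z (schwartzL2 d u)) = E at herror ⊢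
  have hA : (Complex.I * star z * A).re = z.im * A.re := by
    simp [Complex.mul_re, hreal]
  have hE : -(‖z‖ * ‖E‖) ≤ (Complex.I * star z * E).re := by
    simpa using (abs_le.mp (Complex.abs_re_le_norm (Complex.I * star z * E))).1
  rw [mul_add (Complex.I * star z), Complex.add_re, hA]
  nlinarith [mul_le_mul_of_nonneg_left hprincipal hz.le,
    mul_le_mul_of_nonneg_left herror (norm_nonneg z)]

variable (M) in
theorem exists_coercive_schwartz {z : ℂ} (hz : 0 < z.im) :
    ∃ ν : ℝ, 0 ≤ ν ∧ ∃ c > 0, ∀ f : 𝓢(Space d, ℂ), c * ‖schwartzL2 d f‖ ^ 2 ≤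
      ‖inner ℂ ((1 + (ν : ℂ) • besselL2 d) (schwartzL2 d f))
        (M.stationary z (schwartzL2 d f))‖ := by
  have hz₀ : 0 < ‖z‖ := norm_pos_iff.mpr (by rintro rfl; simp at hz)
  obtain ⟨c₀, hc₀, hell⟩ := M.exists_isElliptic
  set κ : ℝ := ((2 * π) ^ 2)⁻¹ with hκ
  have hκ₀ : 0 < κ := by positivity
  obtain ⟨ν, hν, c, hc, hcomb⟩ := exists_coercive_combination
    (m := z.im * min c₀ (‖z‖ ^ 2)) (p := κ * (z.im * c₀)) (by positivity) (by positivity)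
    (κ * (‖z‖ * (∑ l, ‖M.mulDMatrix l‖ + d * ‖M.lowerOrder z‖))) (κ * d)
  refine ⟨ν, hν, c / ‖z‖, by positivity, fun f => ?_⟩
  obtain ⟨u, hu, hf⟩ := exists_schwartz_besselL2 f
  rw [← hκ] at hf
  have hh : M.H0 (u : 𝓢'(Space d, ℂ)) = l2Emb d (M.H0Bessel (schwartzL2 d f)) := by
    rw [l2Emb_H0Bessel, hu, l2Emb_schwartzL2]
  have hnorm : ‖schwartzL2 d f‖ ≤ ‖schwartzJet d u‖ + κ * d * ‖schwartzHess u‖ := by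
    rw [hf]
    exact norm_schwartzL2_sub_smul_laplacian_le u hκ₀.le
  have hmain := hcomb (norm_nonneg _) hnorm (first_order_estimate hz hell hh)
    ((mul_le_mul_of_nonneg_left (second_order_estimate hz hell hh) hκ₀.le).trans_eq' (by ring))
  rw [div_mul_eq_mul_div, div_le_iff₀' hz₀]
  have hω : ∀ w : ℂ, ‖Complex.I * star z * w‖ = ‖z‖ * ‖w‖ := fun w => by simp
  rw [← hω]
  refine hmain.trans (le_of_eq_of_le ?_ (Complex.re_le_norm _))
  rw [← Complex.re_ofReal_mul, ← Complex.re_ofReal_mul, ← Complex.add_re, M.stationary_apply, hu,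
    add_apply, smul_apply, hu, one_apply_eq_self]
  generalize M.H0Bessel (schwartzL2 d f) - M.lowerOrder z (schwartzL2 d u) = w
  rw [hf, inner_add_left, inner_sub_left, inner_smul_left, inner_smul_left, Complex.conj_ofReal,
    Complex.conj_ofReal]
  congr 1
  push_cast
  ring

variable (M)

theorem isUnit_stationary {z : ℂ} (hz : 0 < z.im) : IsUnit (M.stationary z) := by
  obtain ⟨ν, hν, c, hc, hcoercive⟩ := M.exists_coercive_schwartz hz
  refine isUnit_of_le_norm_inner_map_map hc (isUnit_one_add_smul re_inner_besselL2_nonneg hν)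
    fun f => ?_
  exact denseRange_schwartzL2.induction_on f
    (isClosed_le (by fun_prop) (by fun_prop)) hcoercive

theorem exists_isInverse {z : ℂ} (hz : 0 < z.im) : ∃ R, M.IsInverse z R := by
  obtain ⟨T, hT⟩ := M.isUnit_stationary hz
  have hstat : ∀ f, l2Emb d (M.stationary z f) =
      M.H0 (l2Emb d (besselL2 d f)) - l2Emb d (M.lowerOrder z (besselL2 d f)) := fun f => by
    rw [M.stationary_apply, map_sub, l2Emb_H0Bessel]
  refine ⟨besselL2 d ∘L (T⁻¹).val, M.isInverse_iff.mpr fun f u => ⟨?_, ?_⟩⟩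
  · rintro rfl
    have hf : M.stationary z ((T⁻¹).val f) = f := by
      rw [← hT, ← mul_apply_eq_comp, T.mul_inv, one_apply_eq_self]
    refine ⟨memSobolev_besselL2 _, ?_⟩
    rw [map_add, add_comm, ← sub_eq_iff_eq_add]
    exact (hstat _).symm.trans (congrArg (l2Emb d) hf)
  · rintro ⟨hu, hf⟩
    obtain ⟨g, rfl⟩ := exists_besselL2_eq_of_memSobolev hu
    have hg : T.val g = f := l2Emb_injective d <| by
      rw [hT, hstat, hf, map_add, add_sub_cancel_left]
    have hinv : (T⁻¹).val (T.val g) = g := by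
      rw [← mul_apply_eq_comp, T.inv_mul, one_apply_eq_self]
    rw [ContinuousLinearMap.comp_apply, ← hg, hinv]

theorem isInverse_R {z : ℂ} (hz : 0 < z.im) : M.IsInverse z (M.R z) := by
  rw [R, dif_pos (M.exists_isInverse hz)]
  exact (M.exists_isInverse hz).choose_spec

end Medium

end Coercivity

/-! ### The wave generator and its resolvent -/

theorem closure_graphOn_eq {X Y : Type*} [TopologicalSpace X] [TopologicalSpace Y] [T2Space Y]
    {f : X → Y} (hf : Continuous f) {s : Set X} (hs : Dense s) :
    closure (s.graphOn f) = {p | p.2 = f p.1} := by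
  apply subset_antisymm
  · refine closure_minimal ?_ (isClosed_eq continuous_snd (hf.comp continuous_fst))
    rintro _ ⟨x, -, rfl⟩
    rfl
  · rintro ⟨x, _⟩ (rfl : _ = f x)
    exact image_closure_subset_closure_image (continuous_id.prodMk hf) ⟨x, hs x, rfl⟩

section Generator

variable {d : ℕ} [Fact (3 ≤ d)] {M : Medium d}

theorem Energy.eq_of_dist_eq {U W : Energy M} (hfst : U.fst.dist = W.fst.dist)
    (hsnd : U.snd = W.snd) : U = W :=
  WithLp.ofLp_injective 2 (Prod.ext (HDot.dist_injective hfst) hsnd)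

theorem mem_graph_waveGen_iff {V W : Energy M} : (V, W) ∈ (waveGen M).graph ↔
    W.fst.dist = l2Emb d V.snd ∧
      M.H0 V.fst.dist = l2Emb d (W.snd + Complex.I • M.mulA V.snd) := by
  rw [LinearPMap.mem_graph_iff]
  constructor
  · rintro ⟨U, rfl, rfl⟩
    exact ⟨waveGen_fst_dist M U, by rw [map_add, waveGen_snd, sub_add_cancel]⟩
  · rintro ⟨hfst, hsnd⟩
    refine ⟨⟨V, hfst ▸ W.fst.dist_mem, _, hsnd.symm⟩, rfl, Energy.eq_of_dist_eq ?_ ?_⟩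
    · exact (waveGen_fst_dist M _).trans hfst.symm
    · refine l2Emb_injective d ((waveGen_snd M _).trans (sub_eq_iff_eq_add.mpr ?_))
      exact hsnd.trans (map_add _ _ _)

theorem isClosed_waveGen (M : Medium d) : (waveGen M).IsClosed := by
  have hfst : Continuous fun U : Energy M => U.fst :=
    (WithLp.prod_continuous_ofLp 2 (HDot M) (L2 d)).fst
  have hsnd : Continuous fun U : Energy M => U.snd :=
    (WithLp.prod_continuous_ofLp 2 (HDot M) (L2 d)).snd
  have hgraph : ((waveGen M).graph : Set (Energy M × Energy M)) =
      {p | p.2.fst.dist = l2Emb d p.1.snd} ∩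
        {p | M.H0 p.1.fst.dist = l2Emb d (p.2.snd + Complex.I • M.mulA p.1.snd)} :=
    Set.ext fun _ => mem_graph_waveGen_iff
  rw [LinearPMap.IsClosed, hgraph]
  refine (isClosed_eq ?_ ?_).inter (isClosed_eq ?_ ?_)
  · exact HDot.continuous_dist.comp (hfst.comp continuous_snd)
  · exact continuous_l2Emb.comp (hsnd.comp continuous_fst)
  · exact M.H0.continuous.comp (HDot.continuous_dist.comp (hfst.comp continuous_fst))
  · exact continuous_l2Emb.comp ((hsnd.comp continuous_snd).add
      ((M.mulA.continuous.comp (hsnd.comp continuous_fst)).const_smul Complex.I))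

theorem DomA.gen_fst (U : DomA M) : U.gen.fst = U.vHDot := rfl

theorem DomA.gen_snd (U : DomA M) : U.gen.snd = U.h0 - Complex.I • M.mulA U.incl.snd := rfl

theorem isDissipative_waveGen (M : Medium d) : IsDissipative (waveGen M) := fun (U : DomA M) => by
  obtain ⟨ha, -⟩ := Complex.nonneg_iff.mp (M.inner_mulA_nonneg U.incl.snd)
  have hGreen : inner ℂ U.incl.fst U.vHDot = star (inner ℂ U.incl.snd U.h0) := by
    rw [← HDot.inner_eq_inner_H0 U.vHDot_spec U.h0_spec.symm]
    exact (inner_conj_symm _ _).symm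
  change (inner ℂ U.incl U.gen).im ≤ 0
  rw [WithLp.prod_inner_apply]
  change (inner ℂ U.incl.fst U.vHDot +
    inner ℂ U.incl.snd (U.h0 - Complex.I • M.mulA U.incl.snd)).im ≤ 0
  rw [hGreen, inner_sub_right, inner_smul_right]
  generalize inner ℂ U.incl.snd U.h0 = α
  simpa using ha

theorem l2Emb_mem_hdot_of_memSobolev {u : L2 d} (h : MemSobolev 2 2 (l2Emb d u)) :
    l2Emb d u ∈ hdot d := by
  choose g hg using fun j : Fin d =>
    mem_range_l2Emb_of_memSobolev (by norm_num) (h.lineDerivOp (m := basisVec j))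
  exact mem_hdot_of_lineDerivOp_eq fun j => (hg j).symm

/-- Solving `(𝒜 - z)(u, v) = (f, g)` for `v` leaves `(H₀ - i z a - z²) u = (i a + z) f + g`. -/
theorem DomA.exists_gen_sub_smul_eq {z : ℂ} (hz : 0 < z.im) {F : Energy M} {f u : L2 d}
    (hf : F.fst.dist = l2Emb d f) (hu : u = M.R z (Complex.I • M.mulA f + z • f + F.snd)) :
    ∃ U : DomA M, U.incl.fst.dist = l2Emb d u ∧ U.incl.snd = f + z • u ∧
      U.gen - z • U.incl = F := by
  obtain ⟨hu₂, hH0⟩ := (M.isInverse_iff.mp (M.isInverse_R hz) _ u).mp hu.symm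
  let V : Energy M := WithLp.toLp 2 ((⟨l2Emb d u, l2Emb_mem_hdot_of_memSobolev hu₂⟩ : hdot d),
    f + z • u)
  have hV : V.fst.dist = l2Emb d u := rfl
  have hgraph : (V, F + z • V) ∈ (waveGen M).graph := by
    refine mem_graph_waveGen_iff.mpr ⟨?_, ?_⟩
    · change (F.fst + z • V.fst).dist = l2Emb d (f + z • u)
      rw [map_add, map_smul, hf, hV, map_add, map_smul]
    · rw [hV, hH0]
      change _ = l2Emb d (F.snd + z • (f + z • u) + Complex.I • M.mulA (f + z • u))
      congr 1
      change (Complex.I * z) • M.mulA u + z ^ 2 • u + _ = _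
      rw [map_add, map_smul]
      module
  obtain ⟨U, hUV, hU⟩ := (LinearPMap.mem_graph_iff _).mp hgraph
  exact ⟨U, (congrArg (HDot.dist ·.fst) hUV).trans hV, congrArg (·.snd) hUV,
    sub_eq_iff_eq_add.mpr (hU.trans (congrArg (F + z • ·) hUV.symm))⟩

theorem DomA.isMatrixProduct {z : ℂ} (hz : 0 < z.im) {f g : 𝓢(Space d, ℂ)} {U : DomA M}
    (hU : U.gen - z • U.incl = schwartzPair M f g) : M.IsMatrixProduct z f g U := by
  obtain ⟨W, hfst, hsnd, hW⟩ := DomA.exists_gen_sub_smul_eq hz (F := schwartzPair M f g)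
    (f := schwartzL2 d f) (l2Emb_schwartzL2 f).symm rfl
  obtain rfl : U = W := (isDissipative_waveGen M).injective_sub hz (hU.trans hW.symm)
  refine ⟨hfst.trans (congrArg (l2Emb d) (map_add _ _ _)), hsnd.trans ?_⟩
  change schwartzL2 d f + z • M.R z (_ + schwartzL2 d g) = schwartzL2 d f + M.R z _ + _
  rw [map_add, smul_add, ← map_smul, ← add_assoc, smul_add, smul_smul, smul_smul, sq]
  rfl

theorem DomA.ext_isMatrixProduct {z : ℂ} {f g : 𝓢(Space d, ℂ)} {U W : DomA M}
    (hU : M.IsMatrixProduct z f g U) (hW : M.IsMatrixProduct z f g W) : U = W :=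
  Subtype.ext (Energy.eq_of_dist_eq (hU.1.trans hW.1.symm) (hU.2.trans hW.2.symm))

theorem DomA.surjective_gen_sub_smul {z : ℂ} (hz : 0 < z.im) :
    Function.Surjective fun U : DomA M => U.gen - z • U.incl := by
  refine (isDissipative_waveGen M).surjective_sub (isClosed_waveGen M) hz ?_
  refine (denseRange_schwartzPair M).mono ?_
  rintro _ ⟨⟨f, g⟩, rfl⟩
  obtain ⟨U, -, -, hU⟩ := DomA.exists_gen_sub_smul_eq hz (F := schwartzPair M f g)
    (f := schwartzL2 d f) (l2Emb_schwartzL2 f).symm rfl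
  exact ⟨U, hU⟩

theorem isMaximalDissipative_waveGen (M : Medium d) : IsMaximalDissipative (waveGen M) :=
  (isDissipative_waveGen M).isMaximalDissipative (z := Complex.I) (by simp)
    (DomA.surjective_gen_sub_smul (by simp))

theorem DomA.norm_le (U : DomA M) : ‖U‖ ≤ (1 + ‖M.mulA‖) * ‖U.incl‖ + 2 * ‖U.gen‖ := by
  have hfst : ‖U.vHDot‖ ≤ ‖U.gen‖ := U.gen_fst ▸ WithLp.norm_fst_le _ U.gen
  have hsnd : ‖U.h0‖ ≤ ‖U.gen‖ + ‖M.mulA‖ * ‖U.incl‖ := by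
    rw [← sub_add_cancel U.h0 (Complex.I • M.mulA U.incl.snd), ← U.gen_snd]
    refine norm_add_le_of_le (WithLp.norm_snd_le _ U.gen) ?_
    rw [norm_smul, Complex.norm_I, one_mul]
    exact M.mulA.le_opNorm_of_le (WithLp.norm_snd_le _ U.incl)
  rw [DomA.norm_eq]
  linarith

theorem DomA.exists_norm_le {z : ℂ} (hz : 0 < z.im) :
    ∃ C, ∀ U : DomA M, ‖U‖ ≤ C * ‖U.gen - z • U.incl‖ := by
  refine ⟨(1 + ‖M.mulA‖ + 2 * ‖z‖) * z.im⁻¹ + 2, fun U => ?_⟩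
  have hincl : ‖U.incl‖ ≤ z.im⁻¹ * ‖U.gen - z • U.incl‖ := by
    rw [inv_mul_eq_div, le_div_iff₀ hz, mul_comm]
    exact (isDissipative_waveGen M).im_mul_norm_le z U
  have hgen : ‖U.gen‖ ≤ ‖U.gen - z • U.incl‖ + ‖z‖ * ‖U.incl‖ := by
    simpa [norm_smul] using norm_add_le (U.gen - z • U.incl) (z • U.incl)
  calc ‖U‖ ≤ (1 + ‖M.mulA‖) * ‖U.incl‖ + 2 * ‖U.gen‖ := U.norm_le
    _ ≤ (1 + ‖M.mulA‖ + 2 * ‖z‖) * ‖U.incl‖ + 2 * ‖U.gen - z • U.incl‖ := by linarith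
    _ ≤ (1 + ‖M.mulA‖ + 2 * ‖z‖) * (z.im⁻¹ * ‖U.gen - z • U.incl‖) +
          2 * ‖U.gen - z • U.incl‖ := by gcongr
    _ = _ := by ring

theorem DomA.exists_resolvent {z : ℂ} (hz : 0 < z.im) : ∃ RA : Energy M →L[ℂ] DomA M,
    (∀ F, (RA F).gen - z • (RA F).incl = F) ∧ ∀ U : DomA M, RA (U.gen - z • U.incl) = U := by
  have hinj : Function.Injective fun U : DomA M => U.gen - z • U.incl :=
    (isDissipative_waveGen M).injective_sub hz
  let e : DomA M ≃ₗ[ℂ] Energy M := LinearEquiv.ofBijective (DomA.gen - z • DomA.incl)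
    ⟨hinj, DomA.surjective_gen_sub_smul hz⟩
  obtain ⟨C, hC⟩ := DomA.exists_norm_le (M := M) hz
  exact ⟨e.symm.toLinearMap.mkContinuous C fun F => (hC (e.symm F)).trans_eq
    (congrArg (C * ‖·‖) (e.apply_symm_apply F)), e.apply_symm_apply, e.symm_apply_apply⟩

theorem Medium.matrixGraph_eq_graphOn {z : ℂ} {RA : Energy M → DomA M}
    (hRA : ∀ f g : 𝓢(Space d, ℂ), M.IsMatrixProduct z f g (RA (schwartzPair M f g))) :
    M.matrixGraph z = {F | ∃ f g, F = schwartzPair M f g}.graphOn RA := by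
  ext ⟨F, W⟩
  constructor
  · rintro ⟨f, g, rfl, hW⟩
    exact ⟨_, ⟨f, g, rfl⟩, Prod.ext rfl (DomA.ext_isMatrixProduct (hRA f g) hW)⟩
  · rintro ⟨_, ⟨f, g, rfl⟩, hFW⟩
    obtain ⟨rfl, rfl⟩ := Prod.mk.inj hFW
    exact ⟨f, g, rfl, hRA f g⟩

theorem dense_schwartzPair (M : Medium d) :
    Dense {F : Energy M | ∃ f g : 𝓢(Space d, ℂ), F = schwartzPair M f g} :=
  (denseRange_schwartzPair M).mono (by rintro _ ⟨⟨f, g⟩, rfl⟩; exact ⟨f, g, rfl⟩)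

end Generator

end DampedWave

end

theorem proposition3p5 {d : ℕ} [Fact (3 ≤ d)] (M : Medium d) :
    -- `ℋ` is the Hilbert completion of `𝓢 × 𝓢`
    (CompleteSpace (Energy M) ∧
      Dense {U : Energy M | ∃ f g : 𝓢(Space d, ℂ), U = schwartzPair M f g}) ∧
    (∀ z : ℂ, 0 < z.im →
      -- `R(z)` is well defined
      M.IsInverse z (M.R z) ∧
      ∃ RA : Energy M →L[ℂ] DomA M,
        -- `RA` is the closure of the operator defined by the matrix on `𝓢 × 𝓢`
        (∀ f g : 𝓢(Space d, ℂ), M.IsMatrixProduct z f g (RA (schwartzPair M f g))) ∧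
        closure (M.matrixGraph z) = {p | p.2 = RA p.1} ∧
        -- `RA` is the two-sided inverse of `𝒜 - z`
        (∀ F : Energy M, (RA F).gen - z • (RA F).incl = F) ∧
        (∀ U : DomA M, RA (U.gen - z • U.incl) = U)) ∧
    IsMaximalDissipative (waveGen M) := by
  refine ⟨⟨inferInstance, dense_schwartzPair M⟩, fun z hz => ⟨M.isInverse_R hz, ?_⟩,
    isMaximalDissipative_waveGen M⟩
  obtain ⟨RA, hright, hleft⟩ := DomA.exists_resolvent (M := M) hz
  have hproduct : ∀ f g, M.IsMatrixProduct z f g (RA (schwartzPair M f g)) := fun f g =>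
    DomA.isMatrixProduct hz (hright _)
  refine ⟨RA, hproduct, ?_, hright, hleft⟩
  rw [Medium.matrixGraph_eq_graphOn hproduct]
  exact closure_graphOn_eq RA.continuous (dense_schwartzPair M)
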